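/- Let $\Sigma=(A,G,\alpha,\sigma)$ be a twisted unital discrete C*-dynamical system: $A$ is a unital C*-algebra, $G$ is a discrete group with identity $e$, and $\alpha:G\to\mathrm{Aut}(A)$, $\sigma:G\times G\to\mathcal U(A)$ satisfy, for all $g,h,k\in G$, $$\alpha_g\circ\alpha_h=\mathrm{Ad}(\sigma(g,h))\circ\alpha_{gh},\quad \sigma(g,h)\sigma(gh,k)=\alpha_g(\sigma(h,k))\sigma(g,hk),\quad \sigma(g,e)=\sigma(e,g)=1 .$$ Represent $A$ faithfully and unitally on a Hilbert space $\mathcal H$. The reduced crossed product $C_r^*(\Sigma)$ is the C*-algebra of operators on $\ell^2(G,\mathcal H)$ generated by the operators $\pi(a)$ ($a\in A$) and $\lambda(g)$ ($g\in G$) given by $(\pi(a)\xi)(h)=\alpha_{h^{-1}}(a)\xi(h)$ and $(\lambda(g)\xi)(h)=\sigma(h^{-1},g)\xi(g^{-1}h)$. Let $E:C_r^*(\Sigma)\to A$ be the canonical conditional expectation, i.e. $E(x)\in A\subset\mathcal B(\mathcal H)$ is the $(e,e)$ matrix coefficient of $x$. The system $\Sigma$ has *property (DP)* if, for every $y=y^*\in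 C_r^*(\Sigma)$ with $E(y)=0$, $0$ lies in the norm closure of the convex hull of $\{vyv^*: v \text{ a unitary of } C_r^*(\Sigma)\}$. Ideals are closed and two-sided. An ideal $J$ of $A$ is *invariant* if $\alpha_g(J)\subset J$ for all $g\in G$; $\Sigma$ is *minimal* if $\{0\}$ is the only proper invariant ideal of $A$; a C*-algebra is *simple* if $\{0\}$ is its only proper ideal. A tracial state $\varphi$ of $A$ is *invariant* if $\varphi\circ\alpha_g=\varphi$ for all $g\in G$. The class $\mathcal P$ consists of all PH groups and all groups with property $(P_{\rm com})$, defined as follows. * For $M\subset G\setminus\{e\}$, a set $T\subset G$ is *$M$-large* if $m(G\setminus T)\subset T$ for all $m\in M$. A set $H\subset G$ is a *Powers set* for $F\subset G\setminus\{e\}$ if for every $N\in\mathbb N$ there are $h_1,\dots,h_N\in H$ and pairwise disjoint $T_1,\dots,T_N\subset G$ such that $T_j$ is $h_jFh_j^{-1}$-large for each $j$. For $g\ne e$, $H$ is a *c-Powers set* for $g$ if it is a Powers set for $\{aga^{-1}: a\in M\}$ for every finite nonempty $M\subset H$. The group $G$ is a *PH group* if every finite nonempty $F\subset G\setminus\{e\}$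 can be written as $F=\{f_1,\dots,f_n\}$ so that there are subgroups $G_1\subset\dots\subset G_n$ of $G$ with $G_j$ a c-Powers set for $f_j$, $j=1,\dots,n$. * $G$ has *property $(P_{\rm com})$* if for every finite nonempty $F\subset G\setminus\{e\}$ there are $n\in\mathbb N$, $g_0\in G$ and $U,D_1,\dots,D_n\subset G$ with $G\setminus U\subset D_1\cup\dots\cup D_n$, $gU\cap U=\emptyset$ for all $g\in F$, and $g_0^{-j}D_k\cap D_k=\emptyset$ for all $j\ge1$ and $k=1,\dots,n$. Then: 1. If $\Sigma$ has property (DP) and is minimal, then $C_r^*(\Sigma)$ is simple. 2. If $G\in\mathcal P$ and $A$ has a unique invariant tracial state, then $C_r^*(\Sigma)$ has a unique tracial state. 3. If $G\in\mathcal P$ and $\Sigma$ is minimal, then $C_r^*(\Sigma)$ is simple. -/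

import Mathlib

open scoped Pointwise ComplexOrder

noncomputable section

/-- A twisted action `(α, σ)` of the discrete group `G` on the unital C*-algebra `A`; together with
`A` and `G` this is a twisted unital discrete C*-dynamical system. -/
structure TwistedAction (A : Type*) [CStarAlgebra A] (G : Type*) [Group G] where
  /-- the *-automorphisms `α_g` -/
  α : G → (A ≃⋆ₐ[ℂ] A)
  /-- the unitaries `σ(g, h)` -/
  σ : G → G → unitary A
  α_comp : ∀ (g h : G) (a : A),
    α g (α h a) = (σ g h : A) * α (g * h) a * star (σ g h : A)
  σ_cocycle : ∀ g h k : G,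
    (σ g h : A) * (σ (g * h) k : A) = α g (σ h k : A) * (σ g (h * k) : A)
  σ_one_right : ∀ g : G, σ g 1 = 1
  σ_one_left : ∀ g : G, σ 1 g = 1

/-- The Hilbert space `ℓ²(G, H)`. -/
abbrev EllTwo (G H : Type*) [NormedAddCommGroup H] : Type _ := lp (fun _ : G => H) 2

section WeightedShift

variable {G H : Type*} [NormedAddCommGroup H] [InnerProductSpace ℂ H]

theorem weightedShift_bound (F : G → (H →L[ℂ] H)) (e : G ≃ G) (C : ℝ) (hF : ∀ h, ‖F h‖ ≤ C)
    (ξ : EllTwo G H) :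
    Summable (fun h => ‖F h (ξ (e h))‖ ^ (2 : ENNReal).toReal) ∧
      ∑' h, ‖F h (ξ (e h))‖ ^ (2 : ENNReal).toReal ≤ (C * ‖ξ‖) ^ (2 : ENNReal).toReal := by
  have hp : 0 < (2 : ENNReal).toReal := by norm_num
  by_cases hG : Nonempty G
  swap
  · have : IsEmpty G := not_nonempty_iff.mp hG
    refine ⟨summable_empty, ?_⟩
    rw [tsum_empty]
    have : (2 : ENNReal).toReal = 2 := by norm_num
    rw [this, Real.rpow_two]
    positivity
  have hC : 0 ≤ C := (norm_nonneg _).trans (hF hG.some)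
  have h1 : Summable (fun h => ‖ξ (e h)‖ ^ (2 : ENNReal).toReal) :=
    (e.summable_iff (f := fun h => ‖ξ h‖ ^ (2 : ENNReal).toReal)).2 ((lp.memℓp ξ).summable hp)
  have h2 : ∀ h, ‖F h (ξ (e h))‖ ^ (2 : ENNReal).toReal ≤
      C ^ (2 : ENNReal).toReal * ‖ξ (e h)‖ ^ (2 : ENNReal).toReal := by
    intro h
    rw [← Real.mul_rpow hC (norm_nonneg _)]
    refine Real.rpow_le_rpow (norm_nonneg _) ?_ hp.le
    exact ((F h).le_opNorm _).trans (mul_le_mul_of_nonneg_right (hF h) (norm_nonneg _))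
  have h3 : Summable (fun h => ‖F h (ξ (e h))‖ ^ (2 : ENNReal).toReal) :=
    Summable.of_nonneg_of_le (fun h => by positivity) h2 (h1.mul_left _)
  refine ⟨h3, ?_⟩
  calc ∑' h, ‖F h (ξ (e h))‖ ^ (2 : ENNReal).toReal
      ≤ ∑' h, C ^ (2 : ENNReal).toReal * ‖ξ (e h)‖ ^ (2 : ENNReal).toReal :=
        h3.tsum_le_tsum h2 (h1.mul_left _)
    _ = C ^ (2 : ENNReal).toReal * ∑' h, ‖ξ h‖ ^ (2 : ENNReal).toReal := by
        rw [tsum_mul_left, e.tsum_eq (fun h => ‖ξ h‖ ^ (2 : ENNReal).toReal)]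
    _ = (C * ‖ξ‖) ^ (2 : ENNReal).toReal := by
        rw [Real.mul_rpow hC (norm_nonneg _), lp.norm_rpow_eq_tsum hp]

/-- The bounded operator `(T ξ)(h) = F(h) ξ(e(h))` on `ℓ²(G, H)`, for a bounded family `F` of
bounded operators and a bijection `e` of `G`. -/
def weightedShift (F : G → (H →L[ℂ] H)) (e : G ≃ G) (C : ℝ) (hC : 0 ≤ C)
    (hF : ∀ h, ‖F h‖ ≤ C) : EllTwo G H →L[ℂ] EllTwo G H :=
  LinearMap.mkContinuous
    { toFun := fun ξ => ⟨fun h => F h (ξ (e h)), memℓp_gen (weightedShift_bound F e C hF ξ).1⟩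
      map_add' := fun ξ η => by ext h; exact map_add (F h) _ _
      map_smul' := fun c ξ => by ext h; exact map_smul (F h) c _ }
    C
    (fun ξ => lp.norm_le_of_tsum_le (by norm_num) (by positivity)
      (weightedShift_bound F e C hF ξ).2)

@[simp] theorem weightedShift_apply (F : G → (H →L[ℂ] H)) (e : G ≃ G) (C : ℝ) (hC : 0 ≤ C)
    (hF : ∀ h, ‖F h‖ ≤ C) (ξ : EllTwo G H) (h : G) :
    weightedShift F e C hC hF ξ h = F h (ξ (e h)) := rfl

open scoped Classical in
/-- The `(h, k)` matrix coefficient in `B(H)` of an operator on `ℓ²(G, H)`. -/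
def matrixCoeff (T : EllTwo G H →L[ℂ] EllTwo G H) (h k : G) : H →L[ℂ] H :=
  (lp.evalCLM ℂ (fun _ : G => H) 2 h) ∘L T ∘L
    (lp.singleContinuousLinearMap ℂ (fun _ : G => H) 2 k)

open scoped Classical in
theorem matrixCoeff_apply (T : EllTwo G H →L[ℂ] EllTwo G H) (h k : G) (v : H) :
    matrixCoeff T h k v = T (lp.single 2 k v) h := rfl

end WeightedShift

namespace TwistedAction

variable {A : Type*} [CStarAlgebra A] {G : Type*} [Group G]
  {H : Type*} [NormedAddCommGroup H] [InnerProductSpace ℂ H] [CompleteSpace H]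

theorem norm_rep_le (S : TwistedAction A G) (ρ : A →⋆ₐ[ℂ] (H →L[ℂ] H)) (g : G) (a : A) :
    ‖ρ (S.α g a)‖ ≤ ‖a‖ := by
  refine (NonUnitalStarAlgHom.norm_apply_le ρ _).trans ?_
  exact NonUnitalStarAlgHom.norm_apply_le (S.α g) a

theorem norm_rep_unitary_le (ρ : A →⋆ₐ[ℂ] (H →L[ℂ] H)) (u : unitary A) : ‖ρ (u : A)‖ ≤ 1 := by
  refine (NonUnitalStarAlgHom.norm_apply_le ρ _).trans ?_
  rcases subsingleton_or_nontrivial A with h | h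
  · simp [Subsingleton.elim (u : A) 0]
  · exact (CStarRing.norm_of_mem_unitary u.2).le

/-- The regular representation of `A` on `ℓ²(G, H)` attached to a representation `ρ` of `A` on `H`:
`(π(a) ξ)(h) = α_{h⁻¹}(a) ξ(h)`. -/
def regRep (S : TwistedAction A G) (ρ : A →⋆ₐ[ℂ] (H →L[ℂ] H)) (a : A) :
    EllTwo G H →L[ℂ] EllTwo G H :=
  weightedShift (fun h => ρ (S.α h⁻¹ a)) (Equiv.refl G) ‖a‖ (norm_nonneg a)
    (fun h => S.norm_rep_le ρ h⁻¹ a)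

/-- The operators `(λ(g) ξ)(h) = σ(h⁻¹, g) ξ(g⁻¹ h)` on `ℓ²(G, H)`. -/
def regUnitary (S : TwistedAction A G) (ρ : A →⋆ₐ[ℂ] (H →L[ℂ] H)) (g : G) :
    EllTwo G H →L[ℂ] EllTwo G H :=
  weightedShift (fun h => ρ (S.σ h⁻¹ g : A)) (Equiv.mulLeft g⁻¹) 1 zero_le_one
    (fun h => norm_rep_unitary_le ρ (S.σ h⁻¹ g))

/-- The reduced crossed product `C_r^*(Σ)`: the C*-algebra of operators on `ℓ²(G, H)` generated by
all `π(a)` and all `λ(g)`. It is used for faithful `ρ` only; up to isomorphism it does then not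
depend on `ρ`. -/
def reducedCrossedProduct (S : TwistedAction A G) (ρ : A →⋆ₐ[ℂ] (H →L[ℂ] H)) :
    StarSubalgebra ℂ (EllTwo G H →L[ℂ] EllTwo G H) :=
  (StarAlgebra.adjoin ℂ (Set.range (S.regRep ρ) ∪ Set.range (S.regUnitary ρ))).topologicalClosure

/-- Operators all of whose matrix coefficients lie in `ρ(A)` and that are supported on finitely
many diagonals. -/
def IsBanded (ρ : A →⋆ₐ[ℂ] (H →L[ℂ] H)) (T : EllTwo G H →L[ℂ] EllTwo G H) : Prop :=
  ∃ D : Finset G, ∀ h k : G,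
    matrixCoeff T h k ∈ ρ.range ∧ (h * k⁻¹ ∉ D → matrixCoeff T h k = 0)

theorem isBanded_regRep (S : TwistedAction A G) (ρ : A →⋆ₐ[ℂ] (H →L[ℂ] H)) (a : A) :
    IsBanded ρ (S.regRep ρ a) := by
  classical
  have key : ∀ h k : G, matrixCoeff (S.regRep ρ a) h k =
      if h = k then ρ (S.α h⁻¹ a) else 0 := by
    intro h k
    ext v
    rw [matrixCoeff_apply]
    split_ifs with hk
    · subst hk; simp [regRep]
    · simp [regRep, hk]
  refine ⟨{1}, fun h k => ?_⟩
  rw [key]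
  refine ⟨?_, fun hk => ?_⟩
  · split_ifs
    · exact ⟨_, rfl⟩
    · exact zero_mem _
  · rw [if_neg]
    rintro rfl
    simp at hk

theorem isBanded_regUnitary (S : TwistedAction A G) (ρ : A →⋆ₐ[ℂ] (H →L[ℂ] H)) (g : G) :
    IsBanded ρ (S.regUnitary ρ g) := by
  classical
  have key : ∀ h k : G, matrixCoeff (S.regUnitary ρ g) h k =
      if g⁻¹ * h = k then ρ (S.σ h⁻¹ g : A) else 0 := by
    intro h k
    ext v
    rw [matrixCoeff_apply]
    split_ifs with hk
    · subst hk; simp [regUnitary]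
    · simp [regUnitary, hk]
  refine ⟨{g}, fun h k => ?_⟩
  rw [key]
  refine ⟨?_, fun hk => ?_⟩
  · split_ifs
    · exact ⟨_, rfl⟩
    · exact zero_mem _
  · rw [if_neg]
    rintro rfl
    simp at hk

theorem IsBanded.add {ρ : A →⋆ₐ[ℂ] (H →L[ℂ] H)} {T U : EllTwo G H →L[ℂ] EllTwo G H}
    (hT : IsBanded ρ T) (hU : IsBanded ρ U) : IsBanded ρ (T + U) := by
  classical
  obtain ⟨D, hD⟩ := hT
  obtain ⟨E, hE⟩ := hU
  have key : ∀ h k : G, matrixCoeff (T + U) h k = matrixCoeff T h k + matrixCoeff U h k := by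
    intro h k; ext v; rfl
  refine ⟨D ∪ E, fun h k => ?_⟩
  rw [key]
  refine ⟨add_mem (hD h k).1 (hE h k).1, fun hk => ?_⟩
  rw [Finset.mem_union, not_or] at hk
  rw [(hD h k).2 hk.1, (hE h k).2 hk.2, add_zero]

theorem isBanded_algebraMap (ρ : A →⋆ₐ[ℂ] (H →L[ℂ] H)) (c : ℂ) :
    IsBanded ρ (algebraMap ℂ (EllTwo G H →L[ℂ] EllTwo G H) c) := by
  classical
  have key : ∀ h k : G, matrixCoeff (algebraMap ℂ (EllTwo G H →L[ℂ] EllTwo G H) c) h k =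
      if h = k then algebraMap ℂ (H →L[ℂ] H) c else 0 := by
    intro h k
    ext v
    rw [matrixCoeff_apply]
    split_ifs with hk
    · subst hk; simp [Algebra.algebraMap_eq_smul_one]
    · simp [Algebra.algebraMap_eq_smul_one, hk]
  refine ⟨{1}, fun h k => ?_⟩
  rw [key]
  refine ⟨?_, fun hk => ?_⟩
  · split_ifs
    · exact algebraMap_mem _ c
    · exact zero_mem _
  · rw [if_neg]
    rintro rfl
    simp at hk

theorem IsBanded.mul {ρ : A →⋆ₐ[ℂ] (H →L[ℂ] H)} {T U : EllTwo G H →L[ℂ] EllTwo G H}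
    (hT : IsBanded ρ T) (hU : IsBanded ρ U) : IsBanded ρ (T * U) := by
  classical
  obtain ⟨D, hD⟩ := hT
  obtain ⟨E, hE⟩ := hU
  have key : ∀ h k : G, matrixCoeff (T * U) h k =
      ∑ e ∈ E, matrixCoeff T h (e * k) * matrixCoeff U (e * k) k := by
    intro h k
    ext v
    have h1 : U (lp.single 2 k v) =
        ∑ e ∈ E, lp.single 2 (e * k) (matrixCoeff U (e * k) k v) := by
      ext l
      rw [lp.coeFn_sum, Finset.sum_apply]
      change matrixCoeff U l k v = _
      by_cases hl : l * k⁻¹ ∈ E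
      · rw [Finset.sum_eq_single_of_mem (l * k⁻¹) hl]
        · simp
        · intro b _ hb
          rw [lp.single_apply_ne]
          rintro rfl
          simp at hb
      · rw [(hE l k).2 hl, Finset.sum_eq_zero]
        · rfl
        · intro b hb'
          rw [lp.single_apply_ne]
          rintro rfl
          simp [hb'] at hl
    rw [matrixCoeff_apply, mul_apply_eq_comp, h1, map_sum, lp.coeFn_sum,
      Finset.sum_apply, sum_apply]
    rfl
  refine ⟨D * E, fun h k => ?_⟩
  rw [key]
  refine ⟨sum_mem fun e _ => mul_mem (hD _ _).1 (hE _ _).1, fun hk => ?_⟩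
  refine Finset.sum_eq_zero fun e he => ?_
  rw [(hD h (e * k)).2, zero_mul]
  intro hd
  exact hk (Finset.mem_mul.2 ⟨_, hd, e, he, by group⟩)

theorem IsBanded.star {ρ : A →⋆ₐ[ℂ] (H →L[ℂ] H)} {T : EllTwo G H →L[ℂ] EllTwo G H}
    (hT : IsBanded ρ T) : IsBanded ρ (star T) := by
  classical
  obtain ⟨D, hD⟩ := hT
  have key : ∀ h k : G, matrixCoeff (Star.star T) h k = Star.star (matrixCoeff T k h) := by
    intro h k
    ext v
    refine ext_inner_left ℂ fun w => ?_
    rw [ContinuousLinearMap.star_eq_adjoint, ContinuousLinearMap.star_eq_adjoint,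
      ContinuousLinearMap.adjoint_inner_right, matrixCoeff_apply, matrixCoeff_apply]
    refine (lp.inner_single_left (𝕜 := ℂ) (G := fun _ : G => H) h w _).symm.trans ?_
    rw [ContinuousLinearMap.adjoint_inner_right]
    exact lp.inner_single_right (𝕜 := ℂ) (G := fun _ : G => H) k v _
  refine ⟨D⁻¹, fun h k => ?_⟩
  rw [key]
  refine ⟨star_mem (hD k h).1, fun hk => ?_⟩
  rw [(hD k h).2, star_zero]
  intro hd
  exact hk (Finset.mem_inv.2 ⟨_, hd, by group⟩)

/-- The diagonal coefficient at the identity of an element of `C_r^*(Σ)` lies in the copy `ρ(A)`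
of `A`. -/
theorem exists_rep_eq_matrixCoeff (S : TwistedAction A G) (ρ : A →⋆ₐ[ℂ] (H →L[ℂ] H))
    (hρ : Function.Injective ρ) (x : S.reducedCrossedProduct ρ) :
    ∃ a : A, ρ a = matrixCoeff (x : EllTwo G H →L[ℂ] EllTwo G H) 1 1 := by
  classical
  have hcl : IsClosed (Set.range ρ) :=
    (NonUnitalStarAlgHom.isometry ρ hρ).isClosedEmbedding.isClosed_range
  have hcont : Continuous (fun T : EllTwo G H →L[ℂ] EllTwo G H => matrixCoeff T 1 1) := by
    unfold matrixCoeff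
    fun_prop
  have hx : (x : EllTwo G H →L[ℂ] EllTwo G H) ∈ closure
      ((StarAlgebra.adjoin ℂ (Set.range (S.regRep ρ) ∪ Set.range (S.regUnitary ρ)) :
        StarSubalgebra ℂ _) : Set (EllTwo G H →L[ℂ] EllTwo G H)) := x.2
  have hsub : ((StarAlgebra.adjoin ℂ (Set.range (S.regRep ρ) ∪ Set.range (S.regUnitary ρ)) :
      StarSubalgebra ℂ _) : Set (EllTwo G H →L[ℂ] EllTwo G H)) ⊆
      (fun T => matrixCoeff T 1 1) ⁻¹' (Set.range ρ) := by
    intro T hT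
    have hb : IsBanded ρ T := by
      induction hT using StarAlgebra.adjoin_induction with
      | mem T hT =>
        rcases hT with ⟨a, rfl⟩ | ⟨g, rfl⟩
        · exact isBanded_regRep S ρ a
        · exact isBanded_regUnitary S ρ g
      | algebraMap c => exact isBanded_algebraMap ρ c
      | add T U _ _ h1 h2 => exact h1.add h2
      | mul T U _ _ h1 h2 => exact h1.mul h2
      | star T _ h1 => exact h1.star
    obtain ⟨D, hD⟩ := hb
    exact (hD 1 1).1
  exact closure_minimal hsub (hcl.preimage hcont) hx

/-- The canonical conditional expectation `E : C_r^*(Σ) → A`, where `A` is identified with its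
copy in `B(H)`: the element `E(x)` of `A` is the diagonal coefficient of `x` at the identity of
`G`. -/
def condExp (S : TwistedAction A G) (ρ : A →⋆ₐ[ℂ] (H →L[ℂ] H)) (hρ : Function.Injective ρ)
    (x : S.reducedCrossedProduct ρ) : A :=
  (S.exists_rep_eq_matrixCoeff ρ hρ x).choose

theorem rep_condExp (S : TwistedAction A G) (ρ : A →⋆ₐ[ℂ] (H →L[ℂ] H))
    (hρ : Function.Injective ρ) (x : S.reducedCrossedProduct ρ) :
    ρ (S.condExp ρ hρ x) = matrixCoeff (x : EllTwo G H →L[ℂ] EllTwo G H) 1 1 :=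
  (S.exists_rep_eq_matrixCoeff ρ hρ x).choose_spec

/-- Property (DP): for every self-adjoint `y` in `C_r^*(Σ)` with `E(y) = 0`, zero is in the norm
closure of the convex hull of the unitary orbit of `y`. -/
def HasDP (S : TwistedAction A G) (ρ : A →⋆ₐ[ℂ] (H →L[ℂ] H)) (hρ : Function.Injective ρ) : Prop :=
  ∀ y : S.reducedCrossedProduct ρ, star y = y → S.condExp ρ hρ y = 0 →
    (0 : S.reducedCrossedProduct ρ) ∈ closure (convexHull ℝ
      {x | ∃ v ∈ unitary (S.reducedCrossedProduct ρ), x = v * y * star v})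

/-- A (two-sided) ideal `J` of `A` is invariant if `α_g(J) ⊆ J` for all `g`. -/
def IsInvariantIdeal (S : TwistedAction A G) (J : TwoSidedIdeal A) : Prop :=
  ∀ (g : G) (a : A), a ∈ J → S.α g a ∈ J

/-- The system is minimal: `{0}` is the only proper invariant closed ideal of `A`. -/
def IsMinimal (S : TwistedAction A G) : Prop :=
  ∀ J : TwoSidedIdeal A, IsClosed (J : Set A) → S.IsInvariantIdeal J → (J ≠ ⊤ ↔ J = ⊥)

/-- Invariance of a functional on `A` under the twisted action. -/
def IsInvariantFunctional (S : TwistedAction A G) (φ : A →ₗ[ℂ] ℂ) : Prop :=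
  ∀ (g : G) (a : A), φ (S.α g a) = φ a

end TwistedAction

/-- A C*-algebra is simple if `{0}` is its only proper closed two-sided ideal. -/
def IsCStarSimple (B : Type*) [Ring B] [TopologicalSpace B] : Prop :=
  ∀ J : TwoSidedIdeal B, IsClosed (J : Set B) → (J ≠ ⊤ ↔ J = ⊥)

/-- Tracial states on a unital *-algebra: positive linear functionals `φ` with `φ(1) = 1` and
`φ(a b) = φ(b a)`. -/
structure IsTracialState {B : Type*} [Ring B] [StarRing B] [Algebra ℂ B] (φ : B →ₗ[ℂ] ℂ) :
    Prop where
  nonneg : ∀ a : B, 0 ≤ φ (star a * a)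
  map_one : φ 1 = 1
  trace : ∀ a b : B, φ (a * b) = φ (b * a)

section Groups

variable {G : Type*} [Group G]

/-- `T` is `M`-large: `m (G \ T) ⊆ T` for all `m ∈ M`. -/
def IsLargeFor (M T : Set G) : Prop := ∀ m ∈ M, m • Tᶜ ⊆ T

/-- `H` is a Powers set for `F`: for every `N` there are `h_1, …, h_N ∈ H` and pairwise disjoint
`T_1, …, T_N ⊆ G` such that `T_j` is `h_j F h_j⁻¹`-large. -/
def IsPowersSet (H F : Set G) : Prop :=
  ∀ N : ℕ, ∃ (h : Fin N → G) (T : Fin N → Set G), (∀ j, h j ∈ H) ∧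
    Pairwise (fun i j => Disjoint (T i) (T j)) ∧
    ∀ j, IsLargeFor ((fun f => h j * f * (h j)⁻¹) '' F) (T j)

/-- `H` is a c-Powers set for `g`: it is a Powers set for `{a g a⁻¹ | a ∈ M}` for every finite
nonempty subset `M` of `H`. -/
def IsCPowersSet (H : Set G) (g : G) : Prop :=
  ∀ M : Set G, M.Finite → M.Nonempty → M ⊆ H →
    IsPowersSet H ((fun a => a * g * a⁻¹) '' M)

variable (G)

/-- PH groups: every finite nonempty `F ⊆ G \ {e}` can be enumerated as `f_1, …, f_n` so that there
are subgroups `G_1 ⊆ ⋯ ⊆ G_n` of `G` with `G_j` a c-Powers set for `f_j`. -/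
def IsPHGroup : Prop :=
  ∀ F : Set G, F.Finite → F.Nonempty → 1 ∉ F →
    ∃ (n : ℕ) (f : Fin n → G) (K : Fin n → Subgroup G),
      Function.Injective f ∧ Set.range f = F ∧ Monotone K ∧
      ∀ j, IsCPowersSet (K j : Set G) (f j)

/-- Property `(P_com)`. -/
def HasPcom : Prop :=
  ∀ F : Set G, F.Finite → F.Nonempty → 1 ∉ F →
    ∃ (n : ℕ) (g₀ : G) (U : Set G) (D : Fin n → Set G),
      Uᶜ ⊆ ⋃ k, D k ∧
      (∀ g ∈ F, g • U ∩ U = ∅) ∧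
      ∀ j : ℕ, 1 ≤ j → ∀ k, (g₀ ^ j)⁻¹ • D k ∩ D k = ∅

/-- The class `𝒫` of PH groups and groups with property `(P_com)`. -/
def IsClassP : Prop := IsPHGroup G ∨ HasPcom G

end Groups

end

/-! Everything goes through (DP), which the class 𝒫 implies.

For (DP), approximate `y` by a finite sum `∑ π(c(g)) λ(g)`. The coefficient at the identity is small
because `E(y) = 0`, so it may be removed, leaving a sum supported on a finite set of diagonals that
omits the identity. Conjugation by `λ(h)` moves a support `F` to `hFh⁻¹`, and an operator supported
there has no corner on the complement of an `hFh⁻¹`-large set `T`. Hence it is a sum of one operator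
with range in `ℓ²(T)` and one whose adjoint has range in `ℓ²(T)`. For disjoint `T_j` such ranges are
orthogonal, so a sum of `N` conjugates has norm `O(√N)` and their mean `O(1/√N)`
(`exists_average_le_of_isColoredPowersSet`). Under `(P_com)` the large sets overlap, but boundedly
many colours separate them. For PH groups the terms are averaged one after another along the chain
of subgroups (`exists_average_le_of_isCPowersSet`).

Simplicity: for an ideal `J`, the closure of `E(J ∩ J*)` is an invariant ideal of `A`. If it is `A`,
then `J` contains a self-adjoint `y` with `E(y) = 1`, and averaging `y - 1` towards `0` yields an
invertible element of `J`. If it is zero, then `J = 0` since `E` is faithful.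

Traces: a trace is constant on unitary orbits, so by (DP) it vanishes on the kernel of `E` and is
determined by its restriction to `A`. That restriction is invariant, since `λ(g)` implements `α_g`;
conversely `φ ∘ E` is a trace for every invariant trace `φ`. -/

noncomputable section

/-! ### Matrix coefficients, coordinate projections and supports -/

section WeightedShift

variable {G H : Type*} [NormedAddCommGroup H] [InnerProductSpace ℂ H]

theorem matrixCoeff_ext {T U : EllTwo G H →L[ℂ] EllTwo G H}
    (h : ∀ s t, matrixCoeff T s t = matrixCoeff U s t) : T = U := by
  classical
  refine lp.ext_continuousLinearMap (by norm_num) fun t => ?_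
  ext v s
  exact congrArg (fun R : H →L[ℂ] H => R v) (h s t)

theorem matrixCoeff_add (T U : EllTwo G H →L[ℂ] EllTwo G H) (s t : G) :
    matrixCoeff (T + U) s t = matrixCoeff T s t + matrixCoeff U s t := rfl

theorem matrixCoeff_smul (c : ℂ) (T : EllTwo G H →L[ℂ] EllTwo G H) (s t : G) :
    matrixCoeff (c • T) s t = c • matrixCoeff T s t := rfl

theorem matrixCoeff_zero (s t : G) :
    matrixCoeff (0 : EllTwo G H →L[ℂ] EllTwo G H) s t = 0 := rfl

theorem matrixCoeff_sum {ι : Type*} (I : Finset ι) (T : ι → EllTwo G H →L[ℂ] EllTwo G H)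
    (s t : G) : matrixCoeff (∑ i ∈ I, T i) s t = ∑ i ∈ I, matrixCoeff (T i) s t := by
  classical
  induction I using Finset.induction_on with
  | empty => simp [matrixCoeff_zero]
  | insert i I hi ih => rw [Finset.sum_insert hi, Finset.sum_insert hi, matrixCoeff_add, ih]

theorem continuous_matrixCoeff (s t : G) :
    Continuous (fun T : EllTwo G H →L[ℂ] EllTwo G H => matrixCoeff T s t) := by
  unfold matrixCoeff
  fun_prop

theorem norm_matrixCoeff_le (T : EllTwo G H →L[ℂ] EllTwo G H) (s t : G) :
    ‖matrixCoeff T s t‖ ≤ ‖T‖ := by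
  classical
  refine ContinuousLinearMap.opNorm_le_bound _ (norm_nonneg T) fun v => ?_
  rw [matrixCoeff_apply]
  refine (lp.norm_apply_le_norm (by norm_num) _ s).trans ((T.le_opNorm _).trans ?_)
  rw [lp.norm_single (by norm_num)]

theorem matrixCoeff_star [CompleteSpace H] (T : EllTwo G H →L[ℂ] EllTwo G H) (s t : G) :
    matrixCoeff (star T) s t = star (matrixCoeff T t s) := by
  classical
  ext v
  refine ext_inner_left ℂ fun w => ?_
  rw [ContinuousLinearMap.star_eq_adjoint, ContinuousLinearMap.star_eq_adjoint,
    ContinuousLinearMap.adjoint_inner_right, matrixCoeff_apply, matrixCoeff_apply]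
  refine (lp.inner_single_left (𝕜 := ℂ) (G := fun _ : G => H) s w _).symm.trans ?_
  rw [ContinuousLinearMap.adjoint_inner_right]
  exact lp.inner_single_right (𝕜 := ℂ) (G := fun _ : G => H) t v _

theorem matrixCoeff_weightedShift_mul (F : G → (H →L[ℂ] H)) (e : G ≃ G) (C : ℝ) (hC : 0 ≤ C)
    (hF : ∀ h, ‖F h‖ ≤ C) (T : EllTwo G H →L[ℂ] EllTwo G H) (s t : G) :
    matrixCoeff (weightedShift F e C hC hF * T) s t = F s * matrixCoeff T (e s) t := rfl

theorem matrixCoeff_mul_star_weightedShift [CompleteSpace H] (F : G → (H →L[ℂ] H)) (e : G ≃ G)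
    (C : ℝ) (hC : 0 ≤ C) (hF : ∀ h, ‖F h‖ ≤ C) (T : EllTwo G H →L[ℂ] EllTwo G H) (s t : G) :
    matrixCoeff (T * star (weightedShift F e C hC hF)) s t =
      matrixCoeff T s (e t) * star (F t) := by
  rw [← star_star (T * _), matrixCoeff_star, star_mul, star_star, matrixCoeff_weightedShift_mul,
    matrixCoeff_star, star_mul, star_star]

theorem star_weightedShift [CompleteSpace H] (F : G → (H →L[ℂ] H)) (e : G ≃ G)
    (C : ℝ) (hC : 0 ≤ C) (hF : ∀ h, ‖F h‖ ≤ C) :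
    star (weightedShift F e C hC hF) =
      weightedShift (fun h => star (F (e.symm h))) e.symm C hC
        (fun _ => (norm_star _).trans_le (hF _)) := by
  rw [ContinuousLinearMap.star_eq_adjoint]
  refine ((ContinuousLinearMap.eq_adjoint_iff _ _).2 fun ξ η => ?_).symm
  rw [lp.inner_eq_tsum, lp.inner_eq_tsum, ← e.tsum_eq]
  refine tsum_congr fun h => ?_
  simp [ContinuousLinearMap.star_eq_adjoint, ContinuousLinearMap.adjoint_inner_left]

theorem norm_weightedShift_le (F : G → (H →L[ℂ] H)) (e : G ≃ G)
    (C : ℝ) (hC : 0 ≤ C) (hF : ∀ h, ‖F h‖ ≤ C) : ‖weightedShift F e C hC hF‖ ≤ C :=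
  ContinuousLinearMap.opNorm_le_bound _ hC fun ξ =>
    lp.norm_le_of_tsum_le (by norm_num) (by positivity) (weightedShift_bound F e C hF ξ).2

/-- The projection of `ℓ²(G, H)` onto `ℓ²(X, H)`. -/
def coordProj (X : Set G) : EllTwo G H →L[ℂ] EllTwo G H :=
  open scoped Classical in
  weightedShift (fun h => if h ∈ X then 1 else 0) (Equiv.refl G) 1 zero_le_one (fun h => by
    split_ifs
    · exact ContinuousLinearMap.norm_id_le
    · simp)

open scoped Classical in
theorem coordProj_apply (X : Set G) (ξ : EllTwo G H) (h : G) :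
    coordProj X ξ h = if h ∈ X then ξ h else 0 := by
  unfold coordProj
  rw [weightedShift_apply]
  split_ifs <;> rfl

theorem star_coordProj [CompleteSpace H] (X : Set G) :
    star (coordProj X : EllTwo G H →L[ℂ] EllTwo G H) = coordProj X := by
  classical
  unfold coordProj
  rw [star_weightedShift]
  ext ξ h
  simp only [weightedShift_apply, Equiv.refl_symm, Equiv.refl_apply]
  by_cases h1 : h ∈ X <;> simp [h1]

theorem coordProj_mul_of_disjoint {X Y : Set G} (hXY : Disjoint X Y) :
    (coordProj X : EllTwo G H →L[ℂ] EllTwo G H) * coordProj Y = 0 := by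
  classical
  ext ξ h
  rw [mul_apply_eq_comp, coordProj_apply, coordProj_apply]
  split_ifs with h1 h2
  · exact (Set.disjoint_left.1 hXY h1 h2).elim
  · rfl
  · rfl

theorem coordProj_add_compl (X : Set G) :
    (coordProj X : EllTwo G H →L[ℂ] EllTwo G H) + coordProj Xᶜ = 1 := by
  classical
  ext ξ h
  change coordProj X ξ h + coordProj Xᶜ ξ h = ξ h
  rw [coordProj_apply, coordProj_apply]
  by_cases h1 : h ∈ X <;> simp [h1]

theorem norm_coordProj_le (X : Set G) : ‖(coordProj X : EllTwo G H →L[ℂ] EllTwo G H)‖ ≤ 1 :=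
  norm_weightedShift_le _ _ _ _ _

/-- Partitioning a set by a colouring with finitely many colours partitions its projection. -/
theorem coordProj_eq_sum_color {κ : Type*} [Fintype κ] (X : Set G) (c : G → κ) :
    (coordProj X : EllTwo G H →L[ℂ] EllTwo G H) = ∑ k, coordProj {g ∈ X | c g = k} := by
  classical
  ext ξ h
  rw [sum_apply, lp.coeFn_sum, Finset.sum_apply]
  simp only [coordProj_apply, Set.mem_ofPred_eq]
  by_cases h1 : h ∈ X <;> simp [h1]

open scoped Classical in
theorem matrixCoeff_coordProj_mul_mul_coordProj [CompleteSpace H] (X Y : Set G)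
    (T : EllTwo G H →L[ℂ] EllTwo G H) (s t : G) :
    matrixCoeff (coordProj X * T * coordProj Y) s t =
      if s ∈ X ∧ t ∈ Y then matrixCoeff T s t else 0 := by
  rw [mul_assoc, ← star_coordProj Y]
  unfold coordProj
  rw [matrixCoeff_weightedShift_mul, matrixCoeff_mul_star_weightedShift]
  by_cases h1 : s ∈ X <;> by_cases h2 : t ∈ Y <;> simp [h1, h2]

variable [Group G]

/-- `T` is supported on the diagonals indexed by `D`. -/
def IsSupportedOn (D : Set G) (T : EllTwo G H →L[ℂ] EllTwo G H) : Prop :=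
  ∀ s t : G, s * t⁻¹ ∉ D → matrixCoeff T s t = 0

theorem IsSupportedOn.sum {ι : Type*} {D : Set G} {I : Finset ι}
    {T : ι → EllTwo G H →L[ℂ] EllTwo G H} (h : ∀ i ∈ I, IsSupportedOn D (T i)) :
    IsSupportedOn D (∑ i ∈ I, T i) := fun s t hst => by
  rw [matrixCoeff_sum]
  exact Finset.sum_eq_zero fun i hi => h i hi s t hst

theorem IsSupportedOn.smul {D : Set G} {T : EllTwo G H →L[ℂ] EllTwo G H} (h : IsSupportedOn D T)
    (c : ℂ) : IsSupportedOn D (c • T) := fun s t hst => by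
  rw [matrixCoeff_smul, h s t hst, smul_zero]

theorem IsSupportedOn.mono {D E : Set G} {T : EllTwo G H →L[ℂ] EllTwo G H}
    (h : IsSupportedOn D T) (hDE : D ⊆ E) : IsSupportedOn E T :=
  fun s t hst => h s t fun h' => hst (hDE h')

/-- An operator supported on `D` has no corner on the complement of a `D`-large set. -/
theorem IsSupportedOn.corner_eq_zero [CompleteSpace H] {D X : Set G}
    {T : EllTwo G H →L[ℂ] EllTwo G H} (hT : IsSupportedOn D T) (hX : IsLargeFor D X) :
    coordProj Xᶜ * T * coordProj Xᶜ = 0 := by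
  classical
  refine matrixCoeff_ext fun s t => ?_
  rw [matrixCoeff_coordProj_mul_mul_coordProj, matrixCoeff_zero]
  split_ifs with h
  -- If `s * t⁻¹ ∈ D` with `t ∉ X`, then `s = (s * t⁻¹) * t` lies in `X` by largeness.
  · refine hT s t fun hD => h.1 (hX _ hD ?_)
    exact ⟨t, h.2, by simp⟩
  · rfl

end WeightedShift

/-! ### Norms of sums with orthogonal or boundedly overlapping ranges -/

section Averaging

variable {L : Type*} [CStarAlgebra L]

/-- Sums of elements with orthogonal ranges grow at most like the square root of their number. -/
theorem norm_sq_sum_le_of_orthogonal {ι : Type*} (I : Finset ι) (y : ι → L)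
    (h : ∀ i ∈ I, ∀ j ∈ I, i ≠ j → star (y i) * y j = 0) :
    ‖∑ i ∈ I, y i‖ ^ 2 ≤ ∑ i ∈ I, ‖y i‖ ^ 2 := by
  classical
  have h1 : star (∑ i ∈ I, y i) * ∑ i ∈ I, y i = ∑ i ∈ I, star (y i) * y i := by
    rw [star_sum, Finset.sum_mul_sum]
    refine Finset.sum_congr rfl fun i hi => ?_
    exact Finset.sum_eq_single_of_mem i hi fun j hj hij => h i hi j hj hij.symm
  rw [sq, ← CStarRing.norm_star_mul_self, h1]
  refine (norm_sum_le _ _).trans (Finset.sum_le_sum fun i _ => ?_)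
  rw [CStarRing.norm_star_mul_self, sq]

end Averaging

section Coloring

variable {G H : Type*} [NormedAddCommGroup H] [InnerProductSpace ℂ H] [CompleteSpace H]

/-- Points of one fixed colour cut the sets `X i` down to pairwise disjoint ones. The corresponding
summands have orthogonal ranges, which gives the square root; adding up the colours costs the factor
`card κ`. -/
theorem norm_sum_coordProj_mul_le {ι κ : Type*} [Fintype ι] [Fintype κ] (X : ι → Set G)
    (c : ι → G → κ) (hc : ∀ i j, i ≠ j → ∀ g ∈ X i, g ∈ X j → c i g ≠ c j g)
    (y : ι → EllTwo G H →L[ℂ] EllTwo G H) {C : ℝ} (hC : 0 ≤ C) (hy : ∀ i, ‖y i‖ ≤ C) :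
    ‖∑ i, coordProj (X i) * y i‖ ≤ Fintype.card κ * (√(Fintype.card ι) * C) := by
  have h1 : ∑ i, coordProj (X i) * y i =
      ∑ k, ∑ i, coordProj {g ∈ X i | c i g = k} * y i := by
    rw [Finset.sum_comm]
    refine Finset.sum_congr rfl fun i _ => ?_
    rw [coordProj_eq_sum_color (X i) (c i), Finset.sum_mul]
  have h2 : ∀ k, ‖∑ i, coordProj {g ∈ X i | c i g = k} * y i‖ ≤ √(Fintype.card ι) * C := by
    intro k
    refine abs_le_of_sq_le_sq' ?_ (by positivity) |>.2
    refine (norm_sq_sum_le_of_orthogonal _ _ fun i _ j _ hij => ?_).trans ?_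
    · rw [star_mul, star_coordProj, mul_assoc, ← mul_assoc (coordProj _) (coordProj _),
        coordProj_mul_of_disjoint, zero_mul, mul_zero]
      rw [Set.disjoint_left]
      rintro g ⟨hi, hi'⟩ ⟨hj, hj'⟩
      exact hc i j hij g hi hj (hi'.trans hj'.symm)
    · rw [mul_pow, Real.sq_sqrt (by positivity)]
      calc ∑ i, ‖coordProj {g ∈ X i | c i g = k} * y i‖ ^ 2 ≤ ∑ _i : ι, C ^ 2 := by
            refine Finset.sum_le_sum fun i _ => ?_
            have : ‖coordProj {g ∈ X i | c i g = k} * y i‖ ≤ C :=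
              (norm_mul_le _ _).trans <| (mul_le_mul (norm_coordProj_le _) (hy i)
                (norm_nonneg _) zero_le_one).trans_eq (one_mul C)
            gcongr
        _ = _ := by simp
  rw [h1]
  refine (norm_sum_le _ _).trans ((Finset.sum_le_sum fun k _ => h2 k).trans_eq ?_)
  simp

/-- Operators whose corners vanish off sets that overlap boundedly often sum up to an operator of
small norm. -/
theorem norm_sum_le_of_corner_eq_zero {ι κ : Type*} [Fintype ι] [Fintype κ] (X : ι → Set G)
    (c : ι → G → κ) (hc : ∀ i j, i ≠ j → ∀ g ∈ X i, g ∈ X j → c i g ≠ c j g)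
    (y : ι → EllTwo G H →L[ℂ] EllTwo G H) {C : ℝ} (hC : 0 ≤ C) (hy : ∀ i, ‖y i‖ ≤ C)
    (h0 : ∀ i, coordProj (X i)ᶜ * y i * coordProj (X i)ᶜ = 0) :
    ‖∑ i, y i‖ ≤ 2 * Fintype.card κ * (√(Fintype.card ι) * C) := by
  -- With `P = coordProj (X i)`, the vanishing corner gives `y = P y + (1 - P) y P`. The last term
  -- is the adjoint of `P y* (1 - P)`, so the previous bound covers both sums, whence the factor 2.
  have h1 : ∀ i, y i = coordProj (X i) * y i +
      star (coordProj (X i) * (star (y i) * coordProj (X i)ᶜ)) := by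
    intro i
    have e := coordProj_add_compl (H := H) (X i)
    rw [star_mul, star_mul, star_star, star_coordProj, star_coordProj]
    calc
      y i = coordProj (X i) * y i +
          coordProj (X i)ᶜ * y i * (coordProj (X i) + coordProj (X i)ᶜ) := by
        rw [e, mul_one, ← add_mul, e, one_mul]
      _ = _ := by rw [mul_add, h0, add_zero]
  rw [Finset.sum_congr rfl fun i _ => h1 i, Finset.sum_add_distrib, ← star_sum]
  refine (norm_add_le _ _).trans ?_
  rw [norm_star]
  have h2 := norm_sum_coordProj_mul_le X c hc y hC hy
  have h3 := norm_sum_coordProj_mul_le X c hc (fun i => star (y i) * coordProj (X i)ᶜ) hC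
    fun i => by
      refine (norm_mul_le _ _).trans ((mul_le_mul (norm_star (y i) |>.trans_le (hy i))
        (norm_coordProj_le _) (norm_nonneg _) hC).trans_eq (mul_one C))
  linarith

end Coloring

end

noncomputable section

/-! ### Covariance relations and finite Fourier sums -/

namespace TwistedAction

variable {A : Type*} [CStarAlgebra A] {G : Type*} [Group G]
  {H : Type*} [NormedAddCommGroup H] [InnerProductSpace ℂ H] [CompleteSpace H]

theorem α_one (S : TwistedAction A G) (a : A) : S.α 1 a = a := by
  have h := S.α_comp 1 1 a
  rw [S.σ_one_left, mul_one] at h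
  exact (S.α 1).injective (by simpa using h)

/-- `α_g α_h (a) σ(g, h) = σ(g, h) α_{gh}(a)`. -/
theorem α_α_mul_σ (S : TwistedAction A G) (g h : G) (a : A) :
    S.α g (S.α h a) * (S.σ g h : A) = (S.σ g h : A) * S.α (g * h) a := by
  rw [S.α_comp, mul_assoc, Unitary.coe_star_mul_self, mul_one]

theorem regRep_apply (S : TwistedAction A G) (ρ : A →⋆ₐ[ℂ] (H →L[ℂ] H)) (a : A)
    (ξ : EllTwo G H) (s : G) : S.regRep ρ a ξ s = ρ (S.α s⁻¹ a) (ξ s) := rfl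

theorem regUnitary_apply (S : TwistedAction A G) (ρ : A →⋆ₐ[ℂ] (H →L[ℂ] H)) (g : G)
    (ξ : EllTwo G H) (s : G) :
    S.regUnitary ρ g ξ s = ρ (S.σ s⁻¹ g : A) (ξ (g⁻¹ * s)) := rfl

/-- The regular representation of `A` as a *-homomorphism. -/
def regRepHom (S : TwistedAction A G) (ρ : A →⋆ₐ[ℂ] (H →L[ℂ] H)) :
    A →⋆ₐ[ℂ] (EllTwo G H →L[ℂ] EllTwo G H) where
  toFun := S.regRep ρ
  map_one' := by ext ξ s; simp [regRep_apply]
  map_mul' a b := by ext ξ s; simp [regRep_apply]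
  map_zero' := by ext ξ s; simp [regRep_apply]
  map_add' a b := by ext ξ s; simp [regRep_apply]
  commutes' c := by
    ext ξ s
    rw [regRep_apply, AlgHomClass.commutes, AlgHomClass.commutes]
    simp [Algebra.algebraMap_eq_smul_one]
  map_star' a := by
    unfold regRep
    rw [star_weightedShift]
    ext ξ s
    simp [map_star]

theorem regRepHom_apply (S : TwistedAction A G) (ρ : A →⋆ₐ[ℂ] (H →L[ℂ] H)) (a : A) :
    S.regRepHom ρ a = S.regRep ρ a := rfl

theorem star_regUnitary_mul_self (S : TwistedAction A G) (ρ : A →⋆ₐ[ℂ] (H →L[ℂ] H)) (g : G) :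
    star (S.regUnitary ρ g) * S.regUnitary ρ g = 1 := by
  unfold regUnitary
  rw [star_weightedShift]
  ext ξ s
  rw [mul_apply_eq_comp, weightedShift_apply, weightedShift_apply, ← map_star,
    ← mul_apply_eq_comp, ← map_mul, Unitary.coe_star_mul_self]
  simp

theorem regUnitary_mul_star_self (S : TwistedAction A G) (ρ : A →⋆ₐ[ℂ] (H →L[ℂ] H)) (g : G) :
    S.regUnitary ρ g * star (S.regUnitary ρ g) = 1 := by
  unfold regUnitary
  rw [star_weightedShift]
  ext ξ s
  rw [mul_apply_eq_comp, weightedShift_apply, weightedShift_apply, ← map_star,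
    ← mul_apply_eq_comp, ← map_mul]
  simp

/-- At the coordinate `s` this is the cocycle identity for `(s⁻¹, g, h)`. -/
theorem regUnitary_mul_regUnitary (S : TwistedAction A G) (ρ : A →⋆ₐ[ℂ] (H →L[ℂ] H)) (g h : G) :
    S.regUnitary ρ g * S.regUnitary ρ h =
      S.regRepHom ρ (S.σ g h) * S.regUnitary ρ (g * h) := by
  ext ξ s
  rw [mul_apply_eq_comp, mul_apply_eq_comp, regRepHom_apply, regRep_apply, regUnitary_apply,
    regUnitary_apply, regUnitary_apply, ← mul_apply_eq_comp, ← mul_apply_eq_comp, ← map_mul,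
    ← map_mul, ← S.σ_cocycle]
  simp [mul_assoc]

theorem regUnitary_mul_regRepHom (S : TwistedAction A G) (ρ : A →⋆ₐ[ℂ] (H →L[ℂ] H)) (g : G)
    (a : A) :
    S.regUnitary ρ g * S.regRepHom ρ a = S.regRepHom ρ (S.α g a) * S.regUnitary ρ g := by
  ext ξ s
  rw [mul_apply_eq_comp, mul_apply_eq_comp, regRepHom_apply, regRepHom_apply, regRep_apply,
    regUnitary_apply, regRep_apply, regUnitary_apply, ← mul_apply_eq_comp, ← mul_apply_eq_comp,
    ← map_mul, ← map_mul, S.α_α_mul_σ]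
  simp

theorem regUnitary_one (S : TwistedAction A G) (ρ : A →⋆ₐ[ℂ] (H →L[ℂ] H)) :
    S.regUnitary ρ 1 = 1 := by
  ext ξ s
  simp [regUnitary_apply, S.σ_one_right]

/-- This keeps adjoints of Fourier sums among the Fourier sums. -/
theorem star_regUnitary (S : TwistedAction A G) (ρ : A →⋆ₐ[ℂ] (H →L[ℂ] H)) (g : G) :
    star (S.regUnitary ρ g) = S.regRepHom ρ (star (S.σ g⁻¹ g : A)) * S.regUnitary ρ g⁻¹ := by
  have h : S.regUnitary ρ g⁻¹ * S.regUnitary ρ g = S.regRepHom ρ (S.σ g⁻¹ g) := by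
    rw [regUnitary_mul_regUnitary, inv_mul_cancel, regUnitary_one, mul_one]
  calc star (S.regUnitary ρ g)
      = S.regRepHom ρ (star (S.σ g⁻¹ g : A)) * S.regRepHom ρ (S.σ g⁻¹ g) *
          star (S.regUnitary ρ g) := by
        rw [← map_mul, Unitary.coe_star_mul_self, map_one, one_mul]
    _ = _ := by rw [← h, mul_assoc, mul_assoc, regUnitary_mul_star_self, mul_one]

/-- The finite Fourier sum `∑ π(c(g)) λ(g)`. -/
def fourierSum (S : TwistedAction A G) (ρ : A →⋆ₐ[ℂ] (H →L[ℂ] H)) :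
    (G →₀ A) →ₗ[ℂ] (EllTwo G H →L[ℂ] EllTwo G H) :=
  Finsupp.lsum ℂ fun g =>
    LinearMap.mulRight ℂ (S.regUnitary ρ g) ∘ₗ (S.regRepHom ρ).toAlgHom.toLinearMap

theorem fourierSum_single (S : TwistedAction A G) (ρ : A →⋆ₐ[ℂ] (H →L[ℂ] H)) (g : G) (a : A) :
    S.fourierSum ρ (Finsupp.single g a) = S.regRepHom ρ a * S.regUnitary ρ g := by
  simp [fourierSum]

theorem fourierSum_eq_sum (S : TwistedAction A G) (ρ : A →⋆ₐ[ℂ] (H →L[ℂ] H)) (c : G →₀ A) :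
    S.fourierSum ρ c = ∑ g ∈ c.support, S.regRepHom ρ (c g) * S.regUnitary ρ g := by
  simp [fourierSum, Finsupp.sum]

theorem mul_mem_range_fourierSum (S : TwistedAction A G) (ρ : A →⋆ₐ[ℂ] (H →L[ℂ] H))
    {x y : EllTwo G H →L[ℂ] EllTwo G H} (hx : x ∈ LinearMap.range (S.fourierSum ρ))
    (hy : y ∈ LinearMap.range (S.fourierSum ρ)) : x * y ∈ LinearMap.range (S.fourierSum ρ) := by
  obtain ⟨c, rfl⟩ := hx
  obtain ⟨d, rfl⟩ := hy
  induction c using Finsupp.induction_linear with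
  | zero => simp
  | add c₁ c₂ h₁ h₂ => rw [map_add, add_mul]; exact add_mem h₁ h₂
  | single g a =>
    induction d using Finsupp.induction_linear with
    | zero => simp
    | add d₁ d₂ h₁ h₂ => rw [map_add, mul_add]; exact add_mem h₁ h₂
    | single h b =>
      refine ⟨Finsupp.single (g * h) (a * S.α g b * (S.σ g h : A)), ?_⟩
      rw [fourierSum_single, fourierSum_single, fourierSum_single, map_mul, map_mul]
      calc _ = S.regRepHom ρ a * S.regRepHom ρ (S.α g b) *
            (S.regRepHom ρ (S.σ g h) * S.regUnitary ρ (g * h)) := by simp only [mul_assoc]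
        _ = S.regRepHom ρ a * (S.regRepHom ρ (S.α g b) * S.regUnitary ρ g) *
            S.regUnitary ρ h := by rw [← regUnitary_mul_regUnitary]; simp only [mul_assoc]
        _ = _ := by rw [← regUnitary_mul_regRepHom]; simp only [mul_assoc]

theorem regRepHom_mem_range_fourierSum (S : TwistedAction A G) (ρ : A →⋆ₐ[ℂ] (H →L[ℂ] H))
    (a : A) : S.regRepHom ρ a ∈ LinearMap.range (S.fourierSum ρ) :=
  ⟨Finsupp.single 1 a, by rw [fourierSum_single, regUnitary_one, mul_one]⟩

theorem regUnitary_mem_range_fourierSum (S : TwistedAction A G) (ρ : A →⋆ₐ[ℂ] (H →L[ℂ] H))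
    (g : G) : S.regUnitary ρ g ∈ LinearMap.range (S.fourierSum ρ) :=
  ⟨Finsupp.single g 1, by rw [fourierSum_single, map_one, one_mul]⟩

theorem star_mem_range_fourierSum (S : TwistedAction A G) (ρ : A →⋆ₐ[ℂ] (H →L[ℂ] H))
    {x : EllTwo G H →L[ℂ] EllTwo G H} (hx : x ∈ LinearMap.range (S.fourierSum ρ)) :
    star x ∈ LinearMap.range (S.fourierSum ρ) := by
  obtain ⟨c, rfl⟩ := hx
  induction c using Finsupp.induction_linear with
  | zero => simp
  | add c₁ c₂ h₁ h₂ => rw [map_add, star_add]; exact add_mem h₁ h₂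
  | single g a =>
    rw [fourierSum_single, star_mul, star_regUnitary, ← map_star]
    exact S.mul_mem_range_fourierSum ρ (S.mul_mem_range_fourierSum ρ
      (S.regRepHom_mem_range_fourierSum ρ _) (S.regUnitary_mem_range_fourierSum ρ _))
      (S.regRepHom_mem_range_fourierSum ρ _)

/-- By the covariance relations the Fourier sums form a *-algebra containing the generators; hence
they are dense in the crossed product. -/
theorem adjoin_subset_range_fourierSum (S : TwistedAction A G) (ρ : A →⋆ₐ[ℂ] (H →L[ℂ] H)) :
    ((StarAlgebra.adjoin ℂ (Set.range (S.regRep ρ) ∪ Set.range (S.regUnitary ρ)) :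
      StarSubalgebra ℂ _) : Set (EllTwo G H →L[ℂ] EllTwo G H)) ⊆
      LinearMap.range (S.fourierSum ρ) := by
  intro T hT
  change T ∈ LinearMap.range (S.fourierSum ρ)
  induction hT using StarAlgebra.adjoin_induction with
  | mem T hT =>
    rcases hT with ⟨a, rfl⟩ | ⟨g, rfl⟩
    · exact S.regRepHom_mem_range_fourierSum ρ a
    · exact S.regUnitary_mem_range_fourierSum ρ g
  | algebraMap c =>
    rw [← AlgHomClass.commutes (S.regRepHom ρ)]
    exact S.regRepHom_mem_range_fourierSum ρ _
  | add T U _ _ h1 h2 => exact add_mem h1 h2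
  | mul T U _ _ h1 h2 => exact S.mul_mem_range_fourierSum ρ h1 h2
  | star T _ h1 => exact S.star_mem_range_fourierSum ρ h1

theorem isClosed_reducedCrossedProduct (S : TwistedAction A G) (ρ : A →⋆ₐ[ℂ] (H →L[ℂ] H)) :
    IsClosed (S.reducedCrossedProduct ρ : Set (EllTwo G H →L[ℂ] EllTwo G H)) :=
  StarSubalgebra.isClosed_topologicalClosure _

theorem regRepHom_mem (S : TwistedAction A G) (ρ : A →⋆ₐ[ℂ] (H →L[ℂ] H)) (a : A) :
    S.regRepHom ρ a ∈ S.reducedCrossedProduct ρ :=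
  StarSubalgebra.le_topologicalClosure _
    (StarAlgebra.subset_adjoin ℂ _ (Or.inl ⟨a, rfl⟩))

theorem regUnitary_mem (S : TwistedAction A G) (ρ : A →⋆ₐ[ℂ] (H →L[ℂ] H)) (g : G) :
    S.regUnitary ρ g ∈ S.reducedCrossedProduct ρ :=
  StarSubalgebra.le_topologicalClosure _
    (StarAlgebra.subset_adjoin ℂ _ (Or.inr ⟨g, rfl⟩))

theorem fourierSum_mem (S : TwistedAction A G) (ρ : A →⋆ₐ[ℂ] (H →L[ℂ] H)) (c : G →₀ A) :
    S.fourierSum ρ c ∈ S.reducedCrossedProduct ρ := by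
  rw [fourierSum_eq_sum]
  exact sum_mem fun g _ => mul_mem (S.regRepHom_mem ρ _) (S.regUnitary_mem ρ g)

theorem exists_norm_sub_fourierSum_lt (S : TwistedAction A G) (ρ : A →⋆ₐ[ℂ] (H →L[ℂ] H))
    {x : EllTwo G H →L[ℂ] EllTwo G H} (hx : x ∈ S.reducedCrossedProduct ρ) {ε : ℝ}
    (hε : 0 < ε) : ∃ c : G →₀ A, ‖x - S.fourierSum ρ c‖ < ε := by
  have hx' : x ∈ closure (LinearMap.range (S.fourierSum ρ) :
      Set (EllTwo G H →L[ℂ] EllTwo G H)) :=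
    closure_mono (S.adjoin_subset_range_fourierSum ρ) hx
  obtain ⟨_, ⟨c, rfl⟩, hc⟩ := Metric.mem_closure_iff.1 hx' ε hε
  exact ⟨c, by rwa [← dist_eq_norm]⟩

open scoped Classical in
theorem matrixCoeff_regRepHom_mul_regUnitary (S : TwistedAction A G) (ρ : A →⋆ₐ[ℂ] (H →L[ℂ] H))
    (a : A) (g s t : G) : matrixCoeff (S.regRepHom ρ a * S.regUnitary ρ g) s t =
      if s * t⁻¹ = g then ρ (S.α s⁻¹ a * (S.σ s⁻¹ g : A)) else 0 := by
  ext v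
  rw [matrixCoeff_apply, mul_apply_eq_comp, regRepHom_apply, regRep_apply, regUnitary_apply]
  split_ifs with h
  · subst h
    simp
  · rw [lp.single_apply_ne]
    · simp
    · rintro rfl
      simp at h

theorem isSupportedOn_regRepHom_mul_regUnitary (S : TwistedAction A G)
    (ρ : A →⋆ₐ[ℂ] (H →L[ℂ] H)) (a : A) (g : G) :
    IsSupportedOn {g} (S.regRepHom ρ a * S.regUnitary ρ g) := fun s t hst => by
  classical
  exact (S.matrixCoeff_regRepHom_mul_regUnitary ρ a g s t).trans (if_neg hst)

theorem matrixCoeff_conj_regUnitary (S : TwistedAction A G) (ρ : A →⋆ₐ[ℂ] (H →L[ℂ] H)) (g : G)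
    (T : EllTwo G H →L[ℂ] EllTwo G H) (s t : G) :
    matrixCoeff (S.regUnitary ρ g * T * star (S.regUnitary ρ g)) s t =
      ρ (S.σ s⁻¹ g : A) * matrixCoeff T (g⁻¹ * s) (g⁻¹ * t) * star (ρ (S.σ t⁻¹ g : A)) := by
  unfold regUnitary
  rw [matrixCoeff_mul_star_weightedShift, matrixCoeff_weightedShift_mul]
  rfl

/-- Up to unitary factors, the `(s, t)` coefficient of the conjugate is the `(g⁻¹ s, g⁻¹ t)`
coefficient of `T`, on the diagonal `g⁻¹ (s t⁻¹) g`. -/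
theorem isSupportedOn_conj_regUnitary (S : TwistedAction A G) (ρ : A →⋆ₐ[ℂ] (H →L[ℂ] H))
    (g : G) {T : EllTwo G H →L[ℂ] EllTwo G H} {D : Set G} (hT : IsSupportedOn D T) :
    IsSupportedOn ((fun d => g * d * g⁻¹) '' D)
      (S.regUnitary ρ g * T * star (S.regUnitary ρ g)) := fun s t hst => by
  rw [matrixCoeff_conj_regUnitary, hT, mul_zero, zero_mul]
  intro hD
  exact hst ⟨_, hD, by group⟩

/-! ### The conditional expectation: equivariance and faithfulness -/

section CondExp

variable (S : TwistedAction A G) (ρ : A →⋆ₐ[ℂ] (H →L[ℂ] H)) (hρ : Function.Injective ρ)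

/-- The copy of `A` inside the crossed product. -/
def incl : A →⋆ₐ[ℂ] S.reducedCrossedProduct ρ :=
  (S.regRepHom ρ).codRestrict _ (S.regRepHom_mem ρ)

theorem coe_incl (a : A) :
    (S.incl ρ a : EllTwo G H →L[ℂ] EllTwo G H) = S.regRepHom ρ a := rfl

/-- `λ(g)` as an element of the crossed product. -/
def lam (g : G) : S.reducedCrossedProduct ρ := ⟨S.regUnitary ρ g, S.regUnitary_mem ρ g⟩

theorem lam_mem_unitary (g : G) : S.lam ρ g ∈ unitary (S.reducedCrossedProduct ρ) := by
  rw [Unitary.mem_iff]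
  exact ⟨Subtype.ext (S.star_regUnitary_mul_self ρ g),
    Subtype.ext (S.regUnitary_mul_star_self ρ g)⟩

theorem lam_mul_incl (g : G) (a : A) :
    S.lam ρ g * S.incl ρ a = S.incl ρ (S.α g a) * S.lam ρ g :=
  Subtype.ext (S.regUnitary_mul_regRepHom ρ g a)

theorem incl_α (g : G) (a : A) :
    S.incl ρ (S.α g a) = S.lam ρ g * S.incl ρ a * star (S.lam ρ g) := by
  rw [lam_mul_incl, mul_assoc, (Unitary.mem_iff.1 (S.lam_mem_unitary ρ g)).2, mul_one]

/-- The conditional expectation as a linear map. -/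
def condExpₗ : S.reducedCrossedProduct ρ →ₗ[ℂ] A where
  toFun := S.condExp ρ hρ
  map_add' x y := hρ (by simp only [map_add, rep_condExp]; rfl)
  map_smul' c x := hρ (by simp only [map_smul, rep_condExp]; rfl)

theorem condExpₗ_apply (x : S.reducedCrossedProduct ρ) :
    S.condExpₗ ρ hρ x = S.condExp ρ hρ x := rfl

theorem rep_condExpₗ (x : S.reducedCrossedProduct ρ) :
    ρ (S.condExpₗ ρ hρ x) = matrixCoeff (x : EllTwo G H →L[ℂ] EllTwo G H) 1 1 :=
  S.rep_condExp ρ hρ x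

theorem norm_condExpₗ_le (x : S.reducedCrossedProduct ρ) : ‖S.condExpₗ ρ hρ x‖ ≤ ‖x‖ := by
  rw [← (NonUnitalStarAlgHom.isometry ρ hρ).norm_map_of_map_zero (map_zero ρ), rep_condExpₗ]
  exact norm_matrixCoeff_le _ _ _

theorem continuous_condExpₗ : Continuous (S.condExpₗ ρ hρ) :=
  (LinearMap.mkContinuous _ 1 fun x => by
    rw [one_mul]; exact S.norm_condExpₗ_le ρ hρ x).continuous

theorem condExpₗ_star (x : S.reducedCrossedProduct ρ) :
    S.condExpₗ ρ hρ (star x) = star (S.condExpₗ ρ hρ x) := hρ <| by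
  rw [map_star ρ, rep_condExpₗ, rep_condExpₗ, ← matrixCoeff_star]
  rfl

theorem condExpₗ_incl_mul (a : A) (x : S.reducedCrossedProduct ρ) :
    S.condExpₗ ρ hρ (S.incl ρ a * x) = a * S.condExpₗ ρ hρ x := hρ <| by
  rw [map_mul ρ, rep_condExpₗ, rep_condExpₗ]
  refine (matrixCoeff_weightedShift_mul (fun h => ρ (S.α h⁻¹ a)) (Equiv.refl G) ‖a‖
    (norm_nonneg a) (fun h => S.norm_rep_le ρ h⁻¹ a) x 1 1).trans ?_
  rw [inv_one, α_one, Equiv.refl_apply]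

theorem condExpₗ_mul_incl (a : A) (x : S.reducedCrossedProduct ρ) :
    S.condExpₗ ρ hρ (x * S.incl ρ a) = S.condExpₗ ρ hρ x * a := by
  have h := S.condExpₗ_incl_mul ρ hρ (star a) (star x)
  rw [map_star, ← star_mul, condExpₗ_star, condExpₗ_star, ← star_mul] at h
  exact star_injective h

theorem condExpₗ_one : S.condExpₗ ρ hρ 1 = 1 := hρ <| by
  classical
  rw [rep_condExpₗ, map_one]
  ext v
  change (lp.single 2 (1 : G) v : EllTwo G H) 1 = v
  simp

theorem condExpₗ_incl (a : A) : S.condExpₗ ρ hρ (S.incl ρ a) = a := by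
  rw [← mul_one (S.incl ρ a), condExpₗ_incl_mul, condExpₗ_one, mul_one]

theorem condExpₗ_fourierSum (c : G →₀ A) :
    S.condExpₗ ρ hρ ⟨S.fourierSum ρ c, S.fourierSum_mem ρ c⟩ = c 1 := hρ <| by
  classical
  rw [rep_condExpₗ]
  change matrixCoeff (S.fourierSum ρ c) 1 1 = _
  simp only [fourierSum_eq_sum, matrixCoeff_sum, matrixCoeff_regRepHom_mul_regUnitary]
  simp +contextual [α_one, S.σ_one_left]

/-- `E(x)` determines the whole diagonal of `x`; both equivariance and faithfulness of `E` rest on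
this. Only the identity term of a Fourier sum meets the diagonal, and density does the rest. -/
theorem matrixCoeff_inv_inv (x : S.reducedCrossedProduct ρ) (g : G) :
    matrixCoeff (x : EllTwo G H →L[ℂ] EllTwo G H) g⁻¹ g⁻¹ =
      ρ (S.α g (S.condExpₗ ρ hρ x)) := by
  classical
  have hcl : IsClosed {y : S.reducedCrossedProduct ρ |
      matrixCoeff (y : EllTwo G H →L[ℂ] EllTwo G H) g⁻¹ g⁻¹ =
        ρ (S.α g (S.condExpₗ ρ hρ y))} := by
    refine isClosed_eq ((continuous_matrixCoeff _ _).comp continuous_subtype_val) ?_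
    refine (NonUnitalStarAlgHom.isometry ρ hρ).continuous.comp ?_
    exact (NonUnitalStarAlgHom.isometry (S.α g) (S.α g).injective).continuous.comp
      (S.continuous_condExpₗ ρ hρ)
  have hF : ∀ c : G →₀ A, (⟨S.fourierSum ρ c, S.fourierSum_mem ρ c⟩ :
      S.reducedCrossedProduct ρ) ∈ {y : S.reducedCrossedProduct ρ |
      matrixCoeff (y : EllTwo G H →L[ℂ] EllTwo G H) g⁻¹ g⁻¹ =
        ρ (S.α g (S.condExpₗ ρ hρ y))} := by
    intro c
    change matrixCoeff (S.fourierSum ρ c) _ _ = _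
    rw [condExpₗ_fourierSum]
    simp only [fourierSum_eq_sum, matrixCoeff_sum, matrixCoeff_regRepHom_mul_regUnitary]
    simp +contextual [S.σ_one_right]
  refine (hcl.closure_subset_iff.2 (Set.Subset.refl _)) (Metric.mem_closure_iff.2 fun ε hε => ?_)
  obtain ⟨c, hc⟩ := S.exists_norm_sub_fourierSum_lt ρ x.2 hε
  exact ⟨_, hF c, (dist_eq_norm _ _).trans_lt hc⟩

theorem condExpₗ_conj_lam (x : S.reducedCrossedProduct ρ) (g : G) :
    S.condExpₗ ρ hρ (S.lam ρ g * x * star (S.lam ρ g)) = S.α g (S.condExpₗ ρ hρ x) := hρ <| by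
  rw [rep_condExpₗ, ← matrixCoeff_inv_inv]
  refine (S.matrixCoeff_conj_regUnitary ρ g x 1 1).trans ?_
  simp [S.σ_one_left]

/-- The conditional expectation is faithful. -/
theorem eq_zero_of_condExpₗ_star_mul_self (x : S.reducedCrossedProduct ρ)
    (hx : S.condExpₗ ρ hρ (star x * x) = 0) : x = 0 := by
  classical
  refine Subtype.ext (matrixCoeff_ext fun s t => ?_)
  rw [ZeroMemClass.coe_zero, matrixCoeff_zero]
  have h1 : matrixCoeff (star (x : EllTwo G H →L[ℂ] EllTwo G H) *
      (x : EllTwo G H →L[ℂ] EllTwo G H)) t t = 0 := by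
    have := S.matrixCoeff_inv_inv ρ hρ (star x * x) t⁻¹
    rw [hx, map_zero, map_zero, inv_inv] at this
    exact this
  ext v
  -- The squared norm of this vector is the inner product of `v` with the `(t, t)` coefficient of
  -- `x* x` applied to `v`.
  have h2 : (x : EllTwo G H →L[ℂ] EllTwo G H) (lp.single 2 t v) = 0 := by
    rw [← inner_self_eq_zero (𝕜 := ℂ), ← ContinuousLinearMap.adjoint_inner_right]
    refine (lp.inner_single_left (𝕜 := ℂ) (G := fun _ : G => H) t v _).trans ?_
    have := congrArg (fun R : H →L[ℂ] H => R v) h1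
    rw [ContinuousLinearMap.star_eq_adjoint] at this
    rw [show (ContinuousLinearMap.adjoint (x : EllTwo G H →L[ℂ] EllTwo G H)
      ((x : EllTwo G H →L[ℂ] EllTwo G H) (lp.single 2 t v))) t = 0 from this, inner_zero_right]
  rw [matrixCoeff_apply, h2]
  rfl

/-- Since `λ(g) x = λ(g) (x λ(g)) λ(g)*`, this is equivariance of `E`. It makes `φ ∘ E` tracial when
`φ` is an invariant trace. -/
theorem condExpₗ_lam_mul (x : S.reducedCrossedProduct ρ) (g : G) :
    S.condExpₗ ρ hρ (S.lam ρ g * x) = S.α g (S.condExpₗ ρ hρ (x * S.lam ρ g)) := by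
  rw [← condExpₗ_conj_lam, ← mul_assoc, mul_assoc _ _ (star _),
    (Unitary.mem_iff.1 (S.lam_mem_unitary ρ g)).2, mul_one]

end CondExp

end TwistedAction

end

noncomputable section

/-! ### Averaging over unitaries, Powers sets and property (DP) -/

section Average

variable {L : Type*} [CStarAlgebra L]

/-- The mean of the conjugates `v i * x * (v i)*`. -/
def average {ι : Type*} [Fintype ι] (v : ι → L) (x : L) : L :=
  (Fintype.card ι : ℂ)⁻¹ • ∑ i, v i * x * star (v i)

theorem average_add {ι : Type*} [Fintype ι] (v : ι → L) (x y : L) :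
    average v (x + y) = average v x + average v y := by
  simp [average, mul_add, add_mul, Finset.sum_add_distrib]

theorem average_sum {ι κ : Type*} [Fintype ι] (v : ι → L) (J : Finset κ) (x : κ → L) :
    average v (∑ j ∈ J, x j) = ∑ j ∈ J, average v (x j) := by
  simp only [average, Finset.mul_sum, Finset.sum_mul, ← Finset.smul_sum]
  rw [Finset.sum_comm]

/-- Successive averages thus remain a single average over unitaries, as the induction for PH groups
needs. -/
theorem average_average {ι κ : Type*} [Fintype ι] [Fintype κ] (w : κ → L) (v : ι → L) (x : L) :
    average w (average v x) = average (fun p : κ × ι => w p.1 * v p.2) x := by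
  simp only [average, Fintype.sum_prod_type, Finset.smul_sum, Finset.mul_sum, Finset.sum_mul,
    Fintype.card_prod, star_mul, mul_smul_comm, smul_mul_assoc, smul_smul, mul_assoc]
  simp [mul_comm]

theorem norm_average_le {ι : Type*} [Fintype ι] (v : ι → L) (hv : ∀ i, v i ∈ unitary L) (x : L) :
    ‖average v x‖ ≤ ‖x‖ := by
  have h1 : ‖∑ i, v i * x * star (v i)‖ ≤ Fintype.card ι * ‖x‖ := by
    refine (norm_sum_le _ _).trans (le_of_eq ?_)
    simp [CStarRing.norm_mul_mem_unitary _ (Unitary.star_mem (hv _)),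
      CStarRing.norm_mem_unitary_mul _ (hv _)]
  rw [average, norm_smul, norm_inv, Complex.norm_natCast]
  rcases isEmpty_or_nonempty ι with h | h
  · simp
  · rw [inv_mul_le_iff₀ (by exact_mod_cast Fintype.card_pos)]
    exact h1

end Average

section Groups

variable {G : Type*} [Group G]

/-- A Powers set for `F` in which the large sets need not be disjoint, but may overlap as long as a
colouring with colours in `κ` separates them. -/
def IsColoredPowersSet (κ : Type*) (K F : Set G) : Prop :=
  ∀ N : ℕ, ∃ (h : Fin N → G) (T : Fin N → Set G) (c : Fin N → G → κ), (∀ j, h j ∈ K) ∧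
    (∀ i j, i ≠ j → ∀ g ∈ T i, g ∈ T j → c i g ≠ c j g) ∧
    ∀ j, IsLargeFor ((fun f => h j * f * (h j)⁻¹) '' F) (T j)

theorem IsPowersSet.isColoredPowersSet {K F : Set G} (h : IsPowersSet K F) :
    IsColoredPowersSet Unit K F := fun N => by
  obtain ⟨h, T, hK, hT, hF⟩ := h N
  exact ⟨h, T, fun _ _ => (), hK,
    fun i j hij g hi hj => (Set.disjoint_left.1 (hT hij) hi hj).elim, hF⟩

/-- Take `h_j = g₀ ^ j` and let `T_j` be the translate of `⋃ D_k` by `g₀ ^ j`. The colour of `g` in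
`T_j` is a `k` with `g₀ ^ (-j) * g ∈ D_k`; the extra colour `none` is for points off the union. -/
theorem isColoredPowersSet_of_pcom {n : ℕ} {g₀ : G} {F U : Set G} {D : Fin n → Set G}
    (hUD : Uᶜ ⊆ ⋃ k, D k) (hU : ∀ g ∈ F, g • U ∩ U = ∅)
    (hD : ∀ j : ℕ, 1 ≤ j → ∀ k, (g₀ ^ j)⁻¹ • D k ∩ D k = ∅) :
    IsColoredPowersSet (Option (Fin n)) Set.univ F := fun N => by
  classical
  let c : G → Option (Fin n) := fun g => if h : ∃ k, g ∈ D k then some h.choose else none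
  have hc : ∀ g ∈ ⋃ k, D k, ∃ k, g ∈ D k ∧ c g = some k := by
    intro g hg
    have hg' := Set.mem_iUnion.1 hg
    exact ⟨hg'.choose, hg'.choose_spec, dif_pos hg'⟩
  have key : ∀ i j : Fin N, i < j → ∀ g, (g₀ ^ (i : ℕ))⁻¹ * g ∈ ⋃ k, D k →
      (g₀ ^ (j : ℕ))⁻¹ * g ∈ ⋃ k, D k →
      c ((g₀ ^ (i : ℕ))⁻¹ * g) ≠ c ((g₀ ^ (j : ℕ))⁻¹ * g) := by
    intro i j hij g hi hj heq
    obtain ⟨k, hk, hk'⟩ := hc _ hi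
    obtain ⟨l, hl, hl'⟩ := hc _ hj
    obtain rfl : k = l := Option.some_injective _ (hk'.symm.trans (heq.trans hl'))
    have hij' : (i : ℕ) < j := hij
    -- Equal colours put `g₀ ^ (-j) * g` both in `D k` and in its translate by `g₀ ^ (-(j - i))`.
    refine (Set.eq_empty_iff_forall_notMem.1 (hD (j - i) (by omega) k)) _ ⟨?_, hl⟩
    refine ⟨_, hk, ?_⟩
    have : g₀ ^ (j : ℕ) = g₀ ^ (i : ℕ) * g₀ ^ ((j : ℕ) - i) := by
      rw [← pow_add]; congr 1; omega
    simp only [smul_eq_mul]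
    rw [this]
    group
  refine ⟨fun j => g₀ ^ (j : ℕ), fun j => {g | (g₀ ^ (j : ℕ))⁻¹ * g ∈ ⋃ k, D k},
    fun j g => c ((g₀ ^ (j : ℕ))⁻¹ * g), fun _ => Set.mem_univ _, ?_, ?_⟩
  · intro i j hij g hi hj
    rcases lt_or_gt_of_ne hij with h | h
    · exact key i j h g hi hj
    · exact (key j i h g hj hi).symm
  · rintro j _ ⟨f, hf, rfl⟩ _ ⟨x, hx, rfl⟩
    -- Off `T_j` the translated point lies in `U`; `f` moves it out of `U`, hence into `⋃ D_k`.
    have h1 : (g₀ ^ (j : ℕ))⁻¹ * x ∈ U := by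
      by_contra h
      exact hx (hUD h)
    refine hUD fun h2 => Set.eq_empty_iff_forall_notMem.1 (hU f hf) _ ⟨⟨_, h1, rfl⟩, ?_⟩
    convert h2 using 1
    simp only [smul_eq_mul]
    group

end Groups

namespace TwistedAction

variable {A : Type*} [CStarAlgebra A] {G : Type*} [Group G]
  {H : Type*} [NormedAddCommGroup H] [InnerProductSpace ℂ H] [CompleteSpace H]
  (S : TwistedAction A G) (ρ : A →⋆ₐ[ℂ] (H →L[ℂ] H))

theorem regUnitary_mem_unitary (g : G) :
    S.regUnitary ρ g ∈ unitary (EllTwo G H →L[ℂ] EllTwo G H) :=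
  Unitary.mem_iff.2 ⟨S.star_regUnitary_mul_self ρ g, S.regUnitary_mul_star_self ρ g⟩

/-- The unitaries of the crossed product, as operators. -/
def unitaries : Submonoid (EllTwo G H →L[ℂ] EllTwo G H) :=
  unitary _ ⊓ (S.reducedCrossedProduct ρ).toSubmonoid

theorem regUnitary_mem_unitaries (g : G) : S.regUnitary ρ g ∈ S.unitaries ρ :=
  ⟨S.regUnitary_mem_unitary ρ g, S.regUnitary_mem ρ g⟩

variable {S ρ} in
-- The sum of `N + 1` conjugates has norm at most `a * √(N + 1)`, with `a` independent of `N`, so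
-- the mean is at most `a / √(N + 1)`. Using `N + 1` terms keeps the average nonempty.
theorem exists_average_le_of_isColoredPowersSet {κ : Type*} [Fintype κ] {K F : Set G}
    (hKF : IsColoredPowersSet κ K F) {y : EllTwo G H →L[ℂ] EllTwo G H}
    (hy : IsSupportedOn F y) {ε : ℝ} (hε : 0 < ε) :
    ∃ (N : ℕ) (h : Fin (N + 1) → G), (∀ j, h j ∈ K) ∧
      ‖average (fun j => S.regUnitary ρ (h j)) y‖ ≤ ε := by
  set a : ℝ := 2 * Fintype.card κ * ‖y‖ with ha
  obtain ⟨N, hN⟩ := exists_nat_ge ((a / ε) ^ 2)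
  obtain ⟨h, T, c, hK, hc, hT⟩ := hKF (N + 1)
  refine ⟨N, h, hK, ?_⟩
  have h1 : ‖∑ j, S.regUnitary ρ (h j) * y * star (S.regUnitary ρ (h j))‖ ≤
      2 * Fintype.card κ * (√(Fintype.card (Fin (N + 1))) * ‖y‖) := by
    refine norm_sum_le_of_corner_eq_zero T c hc _ (norm_nonneg y) (fun j => le_of_eq ?_)
      fun j => (S.isSupportedOn_conj_regUnitary ρ (h j) hy).corner_eq_zero (hT j)
    rw [CStarRing.norm_mul_mem_unitary _ (Unitary.star_mem (S.regUnitary_mem_unitary ρ _)),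
      CStarRing.norm_mem_unitary_mul _ (S.regUnitary_mem_unitary ρ _)]
  have h2 : a ≤ ε * √((N : ℝ) + 1) := by
    rw [← div_le_iff₀' hε]
    exact Real.le_sqrt_of_sq_le (by linarith)
  have h3 : √((N : ℝ) + 1) * √((N : ℝ) + 1) = N + 1 := Real.mul_self_sqrt (by positivity)
  rw [average, norm_smul, norm_inv, Complex.norm_natCast,
    inv_mul_le_iff₀ (by exact_mod_cast Fintype.card_pos)]
  refine h1.trans ?_
  rw [Fintype.card_fin]
  push_cast
  calc 2 * (Fintype.card κ : ℝ) * (√((N : ℝ) + 1) * ‖y‖) = a * √((N : ℝ) + 1) := by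
        rw [ha]; ring
    _ ≤ ε * √((N : ℝ) + 1) * √((N : ℝ) + 1) := by gcongr
    _ = _ := by rw [mul_assoc, h3, mul_comm]

/-- Averaging the first term over elements of `K 0` spreads the support of each later term over
finitely many more conjugates of its `f j`. These conjugators stay in `K j` because `K` is
increasing, so the c-Powers condition still applies. The sets `M j` record the conjugators; they let
the induction run. -/
theorem exists_average_le_of_isCPowersSet (n : ℕ) :
    ∀ (f : Fin n → G) (K : Fin n → Subgroup G) (y : Fin n → EllTwo G H →L[ℂ] EllTwo G H)
      (M : Fin n → Set G), Monotone K → (∀ j, IsCPowersSet (K j : Set G) (f j)) →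
      (∀ j, (M j).Finite) → (∀ j, (M j).Nonempty) → (∀ j, M j ⊆ K j) →
      (∀ j, IsSupportedOn ((fun a => a * f j * a⁻¹) '' M j) (y j)) → ∀ ε : ℝ, 0 < ε →
      ∃ (ι : Type) (_ : Fintype ι) (_ : Nonempty ι) (v : ι → EllTwo G H →L[ℂ] EllTwo G H),
        (∀ i, v i ∈ S.unitaries ρ) ∧ ‖average v (∑ j, y j)‖ ≤ ε := by
  induction n with
  | zero =>
    intro f K y M _ _ _ _ _ _ ε hε
    exact ⟨Unit, inferInstance, inferInstance, fun _ => 1, fun _ => one_mem _,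
      by simpa [average] using hε.le⟩
  | succ n ih =>
    intro f K y M hmono hK hfin hne hMK hy ε hε
    obtain ⟨N, h, hh, hN⟩ := exists_average_le_of_isColoredPowersSet (S := S) (ρ := ρ)
      (hK 0 (M 0) (hfin 0) (hne 0) (hMK 0)).isColoredPowersSet (hy 0) (half_pos hε)
    obtain ⟨κ, _, _, w, hw, hw'⟩ := ih (fun j => f j.succ) (fun j => K j.succ)
      (fun j => average (fun i => S.regUnitary ρ (h i)) (y j.succ))
      (fun j => ⋃ i, (fun a => h i * a) '' M j.succ)
      (fun i j hij => hmono (Fin.succ_le_succ_iff.2 hij)) (fun j => hK j.succ)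
      (fun j => Set.finite_iUnion fun i => (hfin j.succ).image _)
      (fun j => by
        obtain ⟨a, ha⟩ := hne j.succ
        exact ⟨_, Set.mem_iUnion.2 ⟨0, a, ha, rfl⟩⟩)
      (fun j => Set.iUnion_subset fun i => by
        rintro _ ⟨a, ha, rfl⟩
        exact mul_mem (hmono (Fin.zero_le _) (hh i)) (hMK _ ha))
      (fun j => by
        refine (IsSupportedOn.sum fun i _ => ?_).smul _
        refine (S.isSupportedOn_conj_regUnitary ρ (h i) (hy j.succ)).mono ?_
        rintro _ ⟨_, ⟨a, ha, rfl⟩, rfl⟩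
        exact ⟨h i * a, Set.mem_iUnion.2 ⟨i, a, ha, rfl⟩, by group⟩)
      (ε / 2) (half_pos hε)
    refine ⟨κ × Fin (N + 1), inferInstance, inferInstance,
      fun p => w p.1 * S.regUnitary ρ (h p.2),
      fun p => mul_mem (hw _) (S.regUnitary_mem_unitaries ρ _), ?_⟩
    rw [← average_average w (fun i => S.regUnitary ρ (h i)), Fin.sum_univ_succ, average_add,
      average_sum, average_add]
    refine (norm_add_le _ _).trans ?_
    -- Later averages are contractions, so the smallness of the first term survives.
    have := norm_average_le w (fun i => (hw i).1)
      (average (fun i => S.regUnitary ρ (h i)) (y 0))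
    linarith

/-- For a PH group each support element is its own term, with `{1}` as initial set of conjugators;
under `(P_com)` the whole sum is averaged at once. -/
theorem exists_average_fourierSum_le (hG : IsClassP G) (c : G →₀ A) (hc : c 1 = 0) {ε : ℝ}
    (hε : 0 < ε) :
    ∃ (ι : Type) (_ : Fintype ι) (_ : Nonempty ι) (v : ι → EllTwo G H →L[ℂ] EllTwo G H),
      (∀ i, v i ∈ S.unitaries ρ) ∧ ‖average v (S.fourierSum ρ c)‖ ≤ ε := by
  classical
  rcases c.support.eq_empty_or_nonempty with h0 | hne
  · refine ⟨Unit, inferInstance, inferInstance, fun _ => 1, fun _ => one_mem _, ?_⟩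
    rw [Finsupp.support_eq_empty.1 h0]
    simpa [average] using hε.le
  have h1 : (1 : G) ∉ (c.support : Set G) := by simpa using hc
  rcases hG with hG | hG
  · obtain ⟨n, f, K, hf, hF, hmono, hK⟩ := hG _ c.support.finite_toSet (by exact_mod_cast hne) h1
    have hsum : S.fourierSum ρ c =
        ∑ j, S.regRepHom ρ (c (f j)) * S.regUnitary ρ (f j) := by
      have : c.support = Finset.univ.image f := by
        apply Finset.coe_injective
        simp [hF]
      rw [fourierSum_eq_sum, this, Finset.sum_image hf.injOn]
    rw [hsum]
    exact S.exists_average_le_of_isCPowersSet ρ n f K _ (fun _ => {1}) hmono hK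
      (fun _ => Set.finite_singleton _) (fun _ => Set.singleton_nonempty _)
      (fun j => Set.singleton_subset_iff.2 (one_mem (K j)))
      (fun j => by simpa using S.isSupportedOn_regRepHom_mul_regUnitary ρ (c (f j)) (f j)) ε hε
  · obtain ⟨n, g₀, U, D, hUD, hU, hD⟩ := hG _ c.support.finite_toSet (by exact_mod_cast hne) h1
    have hsupp : IsSupportedOn (c.support : Set G) (S.fourierSum ρ c) := by
      rw [fourierSum_eq_sum]
      exact IsSupportedOn.sum fun g hg =>
        (S.isSupportedOn_regRepHom_mul_regUnitary ρ (c g) g).mono (by simpa using hg)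
    obtain ⟨N, h, -, hN⟩ := exists_average_le_of_isColoredPowersSet (S := S) (ρ := ρ)
      (isColoredPowersSet_of_pcom hUD hU hD) hsupp hε
    exact ⟨Fin (N + 1), inferInstance, inferInstance, _,
      fun i => S.regUnitary_mem_unitaries ρ (h i), hN⟩

/-- Systems whose group is in the class `𝒫` have property (DP). -/
theorem hasDP_of_isClassP (hρ : Function.Injective ρ) (hG : IsClassP G) : S.HasDP ρ hρ := by
  intro y _ hy
  refine Metric.mem_closure_iff.2 fun ε hε => ?_
  obtain ⟨c, hc⟩ := S.exists_norm_sub_fourierSum_lt ρ y.2 (show (0 : ℝ) < ε / 3 by positivity)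
  have hc1 : ‖c 1‖ < ε / 3 := by
    have h1 : c 1 = -S.condExpₗ ρ hρ (y - ⟨S.fourierSum ρ c, S.fourierSum_mem ρ c⟩) := by
      rw [map_sub, condExpₗ_fourierSum, condExpₗ_apply, hy]
      simp
    rw [h1, norm_neg]
    exact (S.norm_condExpₗ_le ρ hρ _).trans_lt hc
  have hsplit : S.fourierSum ρ (c.erase 1) = S.fourierSum ρ c - S.regRepHom ρ (c 1) := by
    conv_rhs => rw [← Finsupp.single_add_erase 1 c]
    rw [map_add, fourierSum_single, regUnitary_one, mul_one]
    simp
  obtain ⟨ι, _, _, v, hv, hv'⟩ := S.exists_average_fourierSum_le ρ hG (c.erase 1)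
    Finsupp.erase_same (show (0 : ℝ) < ε / 3 by positivity)
  let u : ι → S.reducedCrossedProduct ρ := fun i => ⟨v i, (hv i).2⟩
  have hu : ∀ i, u i ∈ unitary (S.reducedCrossedProduct ρ) := fun i =>
    Unitary.mem_iff.2 ⟨Subtype.ext (Unitary.mem_iff.1 (hv i).1).1,
      Subtype.ext (Unitary.mem_iff.1 (hv i).1).2⟩
  refine ⟨∑ i, (Fintype.card ι : ℝ)⁻¹ • (u i * y * star (u i)), ?_, ?_⟩
  · refine (convex_convexHull ℝ _).sum_mem (fun _ _ => by positivity) (by simp) fun i _ => ?_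
    exact subset_convexHull ℝ _ ⟨u i, hu i, rfl⟩
  · have hcoe : ((∑ i, (Fintype.card ι : ℝ)⁻¹ • (u i * y * star (u i)) :
        S.reducedCrossedProduct ρ) : EllTwo G H →L[ℂ] EllTwo G H) =
        average v (y : EllTwo G H →L[ℂ] EllTwo G H) := by
      rw [← Finset.smul_sum, average]
      have : ∀ x : S.reducedCrossedProduct ρ, (Fintype.card ι : ℝ)⁻¹ • x =
          (Fintype.card ι : ℂ)⁻¹ • x := fun x => by
        rw [← Complex.coe_smul]; simp
      rw [this]
      simp [u]
    rw [dist_comm, dist_zero_right]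
    change ‖((∑ i, (Fintype.card ι : ℝ)⁻¹ • (u i * y * star (u i)) :
        S.reducedCrossedProduct ρ) : EllTwo G H →L[ℂ] EllTwo G H)‖ < ε
    rw [hcoe]
    -- Approximation error, identity term and remaining Fourier sum each contribute at most `ε / 3`
    -- after averaging, the first two strictly less.
    have hy' : (y : EllTwo G H →L[ℂ] EllTwo G H) =
        (y - S.fourierSum ρ c) + (S.regRepHom ρ (c 1) + S.fourierSum ρ (c.erase 1)) := by
      rw [hsplit]; abel
    have h3 : ‖S.regRepHom ρ (c 1)‖ ≤ ‖c 1‖ := NonUnitalStarAlgHom.norm_apply_le _ _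
    rw [hy', average_add, average_add]
    have h4 := norm_average_le v (fun i => (hv i).1) (y - S.fourierSum ρ c)
    have h5 := norm_average_le v (fun i => (hv i).1) (S.regRepHom ρ (c 1))
    have h6 := norm_add_le (average v (y - S.fourierSum ρ c))
      (average v (S.regRepHom ρ (c 1)) + average v (S.fourierSum ρ (c.erase 1)))
    have h7 := norm_add_le (average v (S.regRepHom ρ (c 1)))
      (average v (S.fourierSum ρ (c.erase 1)))
    linarith

end TwistedAction

end

noncomputable section

/-! ### Ideals and simplicity -/

namespace TwistedAction

variable {A : Type*} [CStarAlgebra A] {G : Type*} [Group G]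
  {H : Type*} [NormedAddCommGroup H] [InnerProductSpace ℂ H] [CompleteSpace H]
  (S : TwistedAction A G) (ρ : A →⋆ₐ[ℂ] (H →L[ℂ] H)) (hρ : Function.Injective ρ)

/-- The closure of the image under the conditional expectation of the self-adjoint part of an
ideal of the crossed product. -/
def condExpIdeal (J : TwoSidedIdeal (S.reducedCrossedProduct ρ)) : TwoSidedIdeal A :=
  -- Requiring `star x ∈ J` as well keeps real parts in `J`, as (DP) needs, without invoking
  -- self-adjointness of closed ideals.
  TwoSidedIdeal.mk' (closure (S.condExpₗ ρ hρ '' {x | x ∈ J ∧ star x ∈ J}))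
    (subset_closure ⟨0, ⟨J.zero_mem, by simp⟩, map_zero _⟩)
    (fun {a b} ha hb => map_mem_closure₂ continuous_add ha hb (by
      rintro _ ⟨x, hx, rfl⟩ _ ⟨y, hy, rfl⟩
      exact ⟨x + y, ⟨J.add_mem hx.1 hy.1, by rw [star_add]; exact J.add_mem hx.2 hy.2⟩,
        map_add _ _ _⟩))
    (fun {a} ha => map_mem_closure continuous_neg ha (by
      rintro _ ⟨x, hx, rfl⟩
      exact ⟨-x, ⟨J.neg_mem hx.1, by rw [star_neg]; exact J.neg_mem hx.2⟩, map_neg _ _⟩))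
    (fun {a b} hb => map_mem_closure (continuous_const_mul a) hb (by
      rintro _ ⟨x, hx, rfl⟩
      exact ⟨S.incl ρ a * x, ⟨J.mul_mem_left _ _ hx.1, by
        rw [star_mul]; exact J.mul_mem_right _ _ hx.2⟩, S.condExpₗ_incl_mul ρ hρ _ _⟩))
    (fun {b a} hb => map_mem_closure (f := fun b => b * a) (continuous_mul_const a) hb (by
      rintro _ ⟨x, hx, rfl⟩
      exact ⟨x * S.incl ρ a, ⟨J.mul_mem_right _ _ hx.1, by
        rw [star_mul]; exact J.mul_mem_left _ _ hx.2⟩, S.condExpₗ_mul_incl ρ hρ _ _⟩))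

theorem coe_condExpIdeal (J : TwoSidedIdeal (S.reducedCrossedProduct ρ)) :
    (S.condExpIdeal ρ hρ J : Set A) =
      closure (S.condExpₗ ρ hρ '' {x | x ∈ J ∧ star x ∈ J}) :=
  TwoSidedIdeal.coe_mk' ..

theorem isInvariantIdeal_condExpIdeal (J : TwoSidedIdeal (S.reducedCrossedProduct ρ)) :
    S.IsInvariantIdeal (S.condExpIdeal ρ hρ J) := by
  intro g a ha
  rw [← SetLike.mem_coe, coe_condExpIdeal] at ha ⊢
  refine map_mem_closure
    (NonUnitalStarAlgHom.isometry (S.α g) (S.α g).injective).continuous ha ?_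
  rintro _ ⟨x, hx, rfl⟩
  refine ⟨S.lam ρ g * x * star (S.lam ρ g),
    ⟨J.mul_mem_right _ _ (J.mul_mem_left _ _ hx.1), ?_⟩, S.condExpₗ_conj_lam ρ hρ x g⟩
  rw [star_mul, star_mul, star_star, ← mul_assoc]
  exact J.mul_mem_right _ _ (J.mul_mem_left _ _ hx.2)

theorem smul_mem_of_mem {B : Type*} [Ring B] [Algebra ℂ B] (J : TwoSidedIdeal B) (c : ℂ) {x : B}
    (hx : x ∈ J) : c • x ∈ J := by
  rw [Algebra.smul_def]
  exact J.mul_mem_left _ _ hx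

variable {S ρ hρ} in
-- Each `v (y - 1) v* + 1 = v y v*` lies in `J`, and so does `z + 1` for every convex combination
-- `z` of the `v (y - 1) v*`. By (DP) some such `z` has norm below 1, which makes `z + 1`
-- invertible.
theorem HasDP.one_mem {J : TwoSidedIdeal (S.reducedCrossedProduct ρ)} (hDP : S.HasDP ρ hρ)
    {y : S.reducedCrossedProduct ρ} (hy : star y = y) (hyJ : y ∈ J)
    (hE : S.condExpₗ ρ hρ y = 1) : (1 : S.reducedCrossedProduct ρ) ∈ J := by
  have h0 := hDP (y - 1) (by rw [star_sub, hy, star_one]) (by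
    rw [← condExpₗ_apply, map_sub, hE, condExpₗ_one, sub_self])
  have hconv : convexHull ℝ {x | ∃ v ∈ unitary (S.reducedCrossedProduct ρ),
      x = v * (y - 1) * star v} ⊆ {x | x + 1 ∈ J} := by
    refine convexHull_min ?_ ?_
    · rintro _ ⟨v, hv, rfl⟩
      have : v * (y - 1) * star v + 1 = v * y * star v := by
        rw [mul_sub, sub_mul, mul_one, (Unitary.mem_iff.1 hv).2, sub_add_cancel]
      change _ + 1 ∈ J
      rw [this]
      exact J.mul_mem_right _ _ (J.mul_mem_left _ _ hyJ)
    · intro a ha b hb s t _ _ hst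
      have h1 : s • a + t • b + 1 = (s : ℂ) • (a + 1) + (t : ℂ) • (b + 1) := by
        rw [Complex.coe_smul, Complex.coe_smul, smul_add, smul_add]
        have : (1 : S.reducedCrossedProduct ρ) = s • 1 + t • 1 := by
          rw [← add_smul, hst, one_smul]
        nth_rewrite 1 [this]
        abel
      change s • a + t • b + 1 ∈ J
      rw [h1]
      exact J.add_mem (smul_mem_of_mem J _ ha) (smul_mem_of_mem J _ hb)
  obtain ⟨z, hz, hz'⟩ := Metric.mem_closure_iff.1 h0 1 one_pos
  have : CompleteSpace (S.reducedCrossedProduct ρ) :=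
    (S.isClosed_reducedCrossedProduct ρ).completeSpace_coe
  obtain ⟨u, hu⟩ : IsUnit (z + 1) := by
    have h2 : ‖-z‖ < 1 := by rwa [norm_neg, ← dist_zero_left]
    have := isUnit_one_sub_of_norm_lt_one h2
    rwa [sub_neg_eq_add, add_comm] at this
  have h3 : z + 1 ∈ J := hconv hz
  rw [← u.inv_mul, hu]
  exact J.mul_mem_left _ _ h3

theorem top_of_one_mem {B : Type*} [Ring B] {J : TwoSidedIdeal B} (h : (1 : B) ∈ J) : J = ⊤ := by
  refine top_unique fun x _ => ?_
  have := J.mul_mem_left x 1 h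
  rwa [mul_one] at this

variable {S} in
-- In the zero algebra the zero ideal is not proper, against the equivalence in `IsMinimal`.
theorem IsMinimal.nontrivial (hS : S.IsMinimal) : Nontrivial A := by
  by_contra hA
  rw [not_nontrivial_iff_subsingleton] at hA
  have hcl : IsClosed ((⊥ : TwoSidedIdeal A) : Set A) := (Set.toFinite _).isClosed
  refine (hS ⊥ hcl fun g a ha => ?_).2 rfl ?_
  · rwa [Subsingleton.elim (S.α g a) a]
  · exact top_of_one_mem (by rw [Subsingleton.elim (1 : A) 0]; exact TwoSidedIdeal.zero_mem _)

variable {S ρ hρ} in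
/-- The crossed product of a minimal system with property (DP) is simple. -/
theorem HasDP.isCStarSimple (hDP : S.HasDP ρ hρ) (hS : S.IsMinimal) :
    IsCStarSimple (S.reducedCrossedProduct ρ) := by
  intro J hJ
  have := hS.nontrivial
  have hone : (1 : S.reducedCrossedProduct ρ) ≠ 0 := fun h => by
    have := congrArg (S.condExpₗ ρ hρ) h
    rw [condExpₗ_one, map_zero] at this
    exact one_ne_zero this
  constructor
  · intro hne
    have h1 := hS (S.condExpIdeal ρ hρ J)
      (by rw [coe_condExpIdeal]; exact isClosed_closure)
      (S.isInvariantIdeal_condExpIdeal ρ hρ J)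
    by_cases htop : S.condExpIdeal ρ hρ J = ⊤
    · refine absurd (top_of_one_mem ?_) hne
      have h2 : (1 : A) ∈ closure (S.condExpₗ ρ hρ '' {x | x ∈ J ∧ star x ∈ J}) := by
        rw [← coe_condExpIdeal, htop]
        trivial
      obtain ⟨_, ⟨x, hx, rfl⟩, hx'⟩ := Metric.mem_closure_iff.1 h2 1 one_pos
      obtain ⟨u, hu⟩ : IsUnit (S.condExpₗ ρ hρ x) := by
        rw [dist_eq_norm] at hx'
        simpa using isUnit_one_sub_of_norm_lt_one hx'
      -- Normalise to `E(w) = 1` by the module property; the real part of `w` then has expectation 1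
      -- too.
      set w := S.incl ρ (u⁻¹ : Aˣ) * x with hw
      have hwE : S.condExpₗ ρ hρ w = 1 := by rw [hw, condExpₗ_incl_mul, ← hu, u.inv_mul]
      have hwJ : w ∈ J := J.mul_mem_left _ _ hx.1
      have hwJ' : star w ∈ J := by
        rw [hw, star_mul]
        exact J.mul_mem_right _ _ hx.2
      refine hDP.one_mem (y := (2⁻¹ : ℂ) • (w + star w)) ?_
        (smul_mem_of_mem J _ (J.add_mem hwJ hwJ')) ?_
      · rw [star_smul, star_add, star_star, add_comm]
        simp
      · rw [map_smul, map_add, condExpₗ_star, hwE, star_one, ← two_smul ℂ (1 : A), smul_smul]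
        norm_num
    · have hbot := h1.1 htop
      refine bot_unique fun x hx => ?_
      have h2 : S.condExpₗ ρ hρ (star x * x) ∈ S.condExpIdeal ρ hρ J := by
        rw [← SetLike.mem_coe, coe_condExpIdeal]
        refine subset_closure ⟨_, ⟨J.mul_mem_left _ _ hx, ?_⟩, rfl⟩
        rw [star_mul, star_star]
        exact J.mul_mem_left _ _ hx
      rw [hbot, TwoSidedIdeal.mem_bot] at h2
      rw [TwoSidedIdeal.mem_bot]
      exact S.eq_zero_of_condExpₗ_star_mul_self ρ hρ x h2
  · rintro rfl htop
    have : (1 : S.reducedCrossedProduct ρ) ∈ (⊥ : TwoSidedIdeal (S.reducedCrossedProduct ρ)) := by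
      rw [htop]; trivial
    exact hone ((TwoSidedIdeal.mem_bot _).1 this)

end TwistedAction

end

noncomputable section

/-! ### Tracial states -/

section TracialState

variable {B : Type*} [CStarAlgebra B] {φ : B →ₗ[ℂ] ℂ}

/-- In the spectral order the nonnegative elements are the `b* b`, so `φ` is a positive map, and
positive maps are automatically continuous. -/
theorem IsTracialState.continuous (hφ : IsTracialState φ) : Continuous φ := by
  let _ := CStarAlgebra.spectralOrder B
  have := CStarAlgebra.spectralOrderedRing B
  let f : B →ₚ[ℂ] ℂ := PositiveLinearMap.mk₀ φ fun x hx => by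
    obtain ⟨b, rfl⟩ := CStarAlgebra.nonneg_iff_eq_star_mul_self.1 hx
    exact hφ.nonneg b
  exact map_continuous f

theorem IsTracialState.map_star (hφ : IsTracialState φ) (x : B) : φ (star x) = star (φ x) := by
  let _ := CStarAlgebra.spectralOrder B
  have := CStarAlgebra.spectralOrderedRing B
  let f : B →ₚ[ℂ] ℂ := PositiveLinearMap.mk₀ φ fun x hx => by
    obtain ⟨b, rfl⟩ := CStarAlgebra.nonneg_iff_eq_star_mul_self.1 hx
    exact hφ.nonneg b
  exact StarHomClass.map_star f x

end TracialState

/-- Injective *-homomorphisms of C*-algebras reflect positivity. -/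
theorem spectrumRestricts_of_map {A B : Type*} [CStarAlgebra A] [CStarAlgebra B] (ρ : A →⋆ₐ[ℂ] B)
    (hρ : Function.Injective ρ) {a : A} (ha : IsSelfAdjoint a)
    (h : SpectrumRestricts (ρ a) ContinuousMap.realToNNReal) :
    SpectrumRestricts a ContinuousMap.realToNNReal := by
  have hiso : ∀ b, ‖ρ b‖₊ = ‖b‖₊ := fun b =>
    (NonUnitalStarAlgHom.isometry ρ hρ).nnnorm_map_of_map_zero (map_zero ρ) b
  rw [SpectrumRestricts.nnreal_iff_nnnorm (ha.map ρ) (hiso a).le] at h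
  -- A self-adjoint `a` is positive exactly when `‖(‖a‖ - a)‖ ≤ ‖a‖`, a condition an isometry
  -- preserves and reflects.
  rw [SpectrumRestricts.nnreal_iff_nnnorm ha le_rfl]
  rw [← hiso, map_sub]
  convert h using 3
  rw [IsScalarTower.algebraMap_apply ℝ ℂ A, IsScalarTower.algebraMap_apply ℝ ℂ B,
    AlgHomClass.commutes]

namespace TwistedAction

variable {A : Type*} [CStarAlgebra A] {G : Type*} [Group G]
  {H : Type*} [NormedAddCommGroup H] [InnerProductSpace ℂ H] [CompleteSpace H]
  (S : TwistedAction A G) (ρ : A →⋆ₐ[ℂ] (H →L[ℂ] H)) (hρ : Function.Injective ρ)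

/-- The corner of `x* x` is a positive operator on `H`; positivity passes back along `ρ`, and a
square root exists in `A`. -/
theorem exists_condExpₗ_star_mul_self_eq (x : S.reducedCrossedProduct ρ) :
    ∃ b : A, S.condExpₗ ρ hρ (star x * x) = star b * b := by
  classical
  have hsa : IsSelfAdjoint (S.condExpₗ ρ hρ (star x * x)) := by
    rw [isSelfAdjoint_iff, ← condExpₗ_star, star_mul, star_star]
  have hpos : (matrixCoeff (star (x : EllTwo G H →L[ℂ] EllTwo G H) *
      (x : EllTwo G H →L[ℂ] EllTwo G H)) 1 1).IsPositive := by
    refine (ContinuousLinearMap.isPositive_iff_complex _).2 fun v => ?_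
    have : inner ℂ (matrixCoeff (star (x : EllTwo G H →L[ℂ] EllTwo G H) *
        (x : EllTwo G H →L[ℂ] EllTwo G H)) 1 1 v) v =
        ((‖(x : EllTwo G H →L[ℂ] EllTwo G H) (lp.single 2 1 v)‖ ^ 2 : ℝ) : ℂ) := by
      rw [matrixCoeff_apply, mul_apply_eq_comp, ContinuousLinearMap.star_eq_adjoint]
      refine (lp.inner_single_right (𝕜 := ℂ) (G := fun _ : G => H) 1 v _).symm.trans ?_
      rw [ContinuousLinearMap.adjoint_inner_left, inner_self_eq_norm_sq_to_K]
      simp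
    rw [this]
    simp only [RCLike.re_to_complex, Complex.ofReal_re]
    exact ⟨trivial, by positivity⟩
  have hsp := spectrumRestricts_of_map ρ hρ hsa (by
    rw [rep_condExpₗ]
    exact hpos.spectrumRestricts)
  obtain ⟨b, hb, -, hb'⟩ := CFC.exists_sqrt_of_isSelfAdjoint_of_quasispectrumRestricts hsa hsp
  exact ⟨b, by rw [← hb', hb.star_eq]⟩

/-- The composition of an invariant tracial state with the conditional expectation is a tracial
state. -/
theorem isTracialState_comp_condExpₗ {φ : A →ₗ[ℂ] ℂ} (hφ : IsTracialState φ)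
    (hinv : S.IsInvariantFunctional φ) : IsTracialState (φ ∘ₗ S.condExpₗ ρ hρ) := by
  set τ := φ ∘ₗ S.condExpₗ ρ hρ with hτ
  have hτa : ∀ x, τ x = φ (S.condExpₗ ρ hρ x) := fun _ => rfl
  have hstar : ∀ x, τ (star x) = star (τ x) := fun x => by
    rw [hτa, condExpₗ_star, hφ.map_star, hτa]
  have hcont : Continuous τ := hφ.continuous.comp (S.continuous_condExpₗ ρ hρ)
  have hsum : ∀ (c : G →₀ A) (y : S.reducedCrossedProduct ρ),
      τ (⟨S.fourierSum ρ c, S.fourierSum_mem ρ c⟩ * y) =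
        τ (y * ⟨S.fourierSum ρ c, S.fourierSum_mem ρ c⟩) := by
    intro c y
    have : (⟨S.fourierSum ρ c, S.fourierSum_mem ρ c⟩ : S.reducedCrossedProduct ρ) =
        ∑ g ∈ c.support, S.incl ρ (c g) * S.lam ρ g := by
      refine Subtype.ext ?_
      simp [fourierSum_eq_sum, coe_incl, lam]
    rw [this, Finset.sum_mul, Finset.mul_sum, map_sum, map_sum]
    refine Finset.sum_congr rfl fun g _ => ?_
    -- The trace property of `φ` moves `a` to the right end; equivariance of `E` and invariance of
    -- `φ` then move `λ(g)` there.
    rw [hτa, hτa, mul_assoc, condExpₗ_incl_mul, hφ.trace, ← condExpₗ_mul_incl, mul_assoc,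
      condExpₗ_lam_mul, hinv, mul_assoc]
  refine ⟨fun x => ?_, ?_, fun x y => ?_⟩
  · obtain ⟨b, hb⟩ := S.exists_condExpₗ_star_mul_self_eq ρ hρ x
    rw [hτa, hb]
    exact hφ.nonneg b
  · rw [hτa, condExpₗ_one, hφ.map_one]
  · have hcl : IsClosed {x : S.reducedCrossedProduct ρ | τ (x * y) = τ (y * x)} :=
      isClosed_eq (hcont.comp (continuous_mul_const y)) (hcont.comp (continuous_const_mul y))
    refine (hcl.closure_subset_iff.2 (Set.Subset.refl _)) (Metric.mem_closure_iff.2 fun ε hε => ?_)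
    obtain ⟨c, hc⟩ := S.exists_norm_sub_fourierSum_lt ρ x.2 hε
    exact ⟨_, hsum c y, (dist_eq_norm _ _).trans_lt hc⟩

variable {S ρ hρ} in
-- A trace is constant on the unitary orbit of `y`, hence on its closed convex hull, which contains
-- `0`.
theorem HasDP.tracialState_eq_zero (hDP : S.HasDP ρ hρ) {τ : S.reducedCrossedProduct ρ →ₗ[ℂ] ℂ}
    (hτ : IsTracialState τ) {y : S.reducedCrossedProduct ρ} (hy : star y = y)
    (hE : S.condExpₗ ρ hρ y = 0) : τ y = 0 := by
  have := S.isClosed_reducedCrossedProduct ρ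
  have hcl : IsClosed {x | τ x = τ y} := isClosed_eq hτ.continuous continuous_const
  have hconv : convexHull ℝ {x | ∃ v ∈ unitary (S.reducedCrossedProduct ρ),
      x = v * y * star v} ⊆ {x | τ x = τ y} := by
    refine convexHull_min ?_ ((convex_singleton (τ y)).linear_preimage (τ.restrictScalars ℝ))
    rintro _ ⟨v, hv, rfl⟩
    change τ _ = τ y
    rw [hτ.trace, ← mul_assoc, (Unitary.mem_iff.1 hv).1, one_mul]
  have h0 : τ 0 = τ y := closure_minimal hconv hcl (hDP y hy hE)
  rw [← h0, map_zero]

variable {S ρ hρ} in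
theorem HasDP.tracialState_eq (hDP : S.HasDP ρ hρ) {τ : S.reducedCrossedProduct ρ →ₗ[ℂ] ℂ}
    (hτ : IsTracialState τ) (x : S.reducedCrossedProduct ρ) :
    τ x = τ (S.incl ρ (S.condExpₗ ρ hρ x)) := by
  rw [← sub_eq_zero, ← map_sub]
  set y := x - S.incl ρ (S.condExpₗ ρ hρ x) with hy
  have hE : S.condExpₗ ρ hρ y = 0 := by rw [hy, map_sub, condExpₗ_incl, sub_self]
  have hE' : S.condExpₗ ρ hρ (star y) = 0 := by rw [condExpₗ_star, hE, star_zero]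
  -- (DP) concerns self-adjoint elements only, so the real and imaginary parts of `y` are treated
  -- separately.
  have h1 : τ (y + star y) = 0 := hDP.tracialState_eq_zero hτ
    (by rw [star_add, star_star, add_comm]) (by rw [map_add, hE, hE', add_zero])
  have h2 : τ (Complex.I • (y - star y)) = 0 := hDP.tracialState_eq_zero hτ
    (by rw [star_smul, star_sub, star_star]; simp [← smul_neg])
    (by rw [map_smul, map_sub, hE, hE', sub_zero, smul_zero])
  rw [map_smul, smul_eq_zero_iff_right Complex.I_ne_zero, map_sub, sub_eq_zero] at h2
  rw [map_add, ← h2, ← two_mul] at h1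
  exact (mul_eq_zero.1 h1).resolve_left two_ne_zero

/-- The restriction of a tracial state of the crossed product is an invariant tracial state. -/
theorem isTracialState_comp_incl {τ : S.reducedCrossedProduct ρ →ₗ[ℂ] ℂ}
    (hτ : IsTracialState τ) :
    IsTracialState (τ ∘ₗ (S.incl ρ).toAlgHom.toLinearMap) ∧
      S.IsInvariantFunctional (τ ∘ₗ (S.incl ρ).toAlgHom.toLinearMap) := by
  have happ : ∀ a, (τ ∘ₗ (S.incl ρ).toAlgHom.toLinearMap) a = τ (S.incl ρ a) := fun _ => rfl
  refine ⟨⟨fun a => ?_, ?_, fun a b => ?_⟩, fun g a => ?_⟩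
  · rw [happ, map_mul, map_star]
    exact hτ.nonneg _
  · rw [happ, map_one, hτ.map_one]
  · rw [happ, happ, map_mul (S.incl ρ), map_mul (S.incl ρ), hτ.trace]
  · rw [happ, happ, incl_α, hτ.trace, ← mul_assoc,
      (Unitary.mem_iff.1 (S.lam_mem_unitary ρ g)).1, one_mul]

variable {S ρ hρ} in
theorem HasDP.existsUnique_isTracialState (hDP : S.HasDP ρ hρ)
    (h : ∃! φ : A →ₗ[ℂ] ℂ, IsTracialState φ ∧ S.IsInvariantFunctional φ) :
    ∃! τ : S.reducedCrossedProduct ρ →ₗ[ℂ] ℂ, IsTracialState τ := by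
  obtain ⟨φ, ⟨hφ, hinv⟩, huniq⟩ := h
  refine ⟨φ ∘ₗ S.condExpₗ ρ hρ, S.isTracialState_comp_condExpₗ ρ hρ hφ hinv, fun τ hτ => ?_⟩
  ext x
  rw [hDP.tracialState_eq hτ x, ← huniq _ (S.isTracialState_comp_incl ρ hτ)]
  rfl

end TwistedAction

end

theorem corollary3p10 {A : Type*} [CStarAlgebra A] {G : Type*} [Group G]
    {H : Type*} [NormedAddCommGroup H] [InnerProductSpace ℂ H] [CompleteSpace H]
    (S : TwistedAction A G) (ρ : A →⋆ₐ[ℂ] (H →L[ℂ] H)) (hρ : Function.Injective ρ) :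
    (S.HasDP ρ hρ → S.IsMinimal → IsCStarSimple (S.reducedCrossedProduct ρ)) ∧
    (IsClassP G →
      ((∃! φ : A →ₗ[ℂ] ℂ, IsTracialState φ ∧ S.IsInvariantFunctional φ) →
        ∃! τ : S.reducedCrossedProduct ρ →ₗ[ℂ] ℂ, IsTracialState τ) ∧
      (S.IsMinimal → IsCStarSimple (S.reducedCrossedProduct ρ))) :=
  ⟨fun hDP hS => hDP.isCStarSimple hS, fun hG =>
    ⟨fun h => (S.hasDP_of_isClassP ρ hρ hG).existsUnique_isTracialState h,
      fun hS => (S.hasDP_of_isClassP ρ hρ hG).isCStarSimple hS⟩⟩
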